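/- Let $a>-1$. For $n\ge 1$ put $h=h_n=\frac{1}{2n+a+1}$ and $x_i=h(a+i)$, $i=1,\dots,2n$. Let $L^{\infty,a}$ be the $n\times n$ upper bidiagonal matrix with diagonal $\sqrt{a+n},\sqrt{a+n-1},\dots,\sqrt{a+1}$ and superdiagonal $\sqrt{n-1},\sqrt{n-2},\dots,\sqrt{1}$. Let $F$ be the $n\times n$ flip matrix (ones on the antidiagonal, zeros elsewhere), $\Omega=\operatorname{diag}(-1,1,-1,1,\dots)$, $\nabla$ the $n\times n$ upper bidiagonal matrix with $-1$ on the diagonal and $1$ on the superdiagonal, and $S=-\frac12\Omega\nabla\Omega$. Set $$L_{\rm hard}^{\infty,a}=\sqrt{\tfrac{2}{h}}\,F\,\Omega\,(L^{\infty,a})^{T}\,\Omega\,F$$ and define the error matrix $E=E_n$ by $$L_{\rm hard}^{\infty,a}=-2\operatorname{diag}(\sqrt{x_2},\sqrt{x_4},\dots,\sqrt{x_{2n}})\bigl(\tfrac{1}{2h}\nabla\bigr)+a\operatorname{diag}\Bigl(\tfrac{1}{\sqrt{x_2}},\tfrac{1}{\sqrt{x_4}},\dots,\tfrac{1}{\sqrt{x_{2n}}}\Bigr)S+E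 .$$ The classical Bessel operator with type (i) boundary conditions is the operator in $L^2(0,1)$ with action $$(\mathcal J_a v)(x)=-2\sqrt{x}\,v'(x)+\frac{a}{\sqrt x}\,v(x)$$ on the functions $v$ that are differentiable on $(0,1)$, with $v,\mathcal J_a v\in L^2(0,1)$, $\lim_{x\to1^-}v(x)=0$ and $\lim_{x\to0^+}(\mathcal J_a v)(x)=0$. A number $\sigma\ge0$ is a singular value of $\mathcal J_a$ if there are a nonzero $v$ in this domain (a right singular function) and a $u$ in the domain of the $L^2(0,1)$ adjoint $\mathcal J_a^*$ with $\mathcal J_a v=\sigma u$ and $\mathcal J_a^*u=\sigma v$. Let $$j_a(t)=\sum_{m=0}^\infty\frac{(-1)^m}{m!\,\Gamma(m+a+1)}\Bigl(\frac t2\Bigr)^{2m+a},\qquad t>0,$$ be the Bessel function of the first kind of order $a$. Then: 1. $E$ is upper bidiagonal, and for every fixed $\varepsilon>0$ the entries of $E$ in rows $\lceil\varepsilon/h\rceil,\dots,n$ are uniformly $O(h)$: there is a constant $C=C(a,\varepsilon)$ such that $|E_{ij}|\le Ch$ for all $n$, all $j$ and all $i$ with $\lceil\varepsilon/h\rceil\le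 i\le n$. 2. The singular values of $\mathcal J_a$ with type (i) boundary conditions are simple (the right singular functions of a given singular value are proportional to each other). For every fixed $k\ge1$ the $k$-th least singular value of $\mathcal J_a$ and the $k$-th least positive zero of $j_a$ exist and are equal, and $$\sigma_k(L_{\rm hard}^{\infty,a})\;\longrightarrow\;\sigma_k(\mathcal J_a\text{ with type (i) boundary conditions})\qquad(n\to\infty),$$ where $\sigma_k$ denotes the $k$-th least singular value. -/

import Mathlib

open Set Filter Topology MeasureTheory

/-! ### Matrices of finite difference schemes (rows and columns are indexed from `0`) -/

/-- The `m × n` upper bidiagonal matrix `∇` with `-1` on the diagonal and `1` on the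
superdiagonal. -/
def nablaMatrix (m n : ℕ) : Matrix (Fin m) (Fin n) ℝ :=
  Matrix.of fun i j =>
    if (j : ℕ) = (i : ℕ) then -1 else if (j : ℕ) = (i : ℕ) + 1 then 1 else 0

/-- The diagonal matrix `Ω = diag(-1, 1, -1, 1, …)`. -/
def omegaMatrix (n : ℕ) : Matrix (Fin n) (Fin n) ℝ :=
  Matrix.diagonal fun i => (-1) ^ ((i : ℕ) + 1)

/-- The flip permutation matrix `F`, with ones on the antidiagonal. -/
def flipMatrix (n : ℕ) : Matrix (Fin n) (Fin n) ℝ :=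
  Matrix.of fun i j => if j = i.rev then 1 else 0

/-- The interpolating matrix `S = -½ Ω ∇ Ω`. -/
noncomputable def interpMatrix (m n : ℕ) : Matrix (Fin m) (Fin n) ℝ :=
  (-(1 / 2) : ℝ) • (omegaMatrix m * nablaMatrix m n * omegaMatrix n)

/-- A matrix is upper bidiagonal if it vanishes off the diagonal and the superdiagonal. -/
def IsUpperBidiagonal {n : ℕ} (A : Matrix (Fin n) (Fin n) ℝ) : Prop :=
  ∀ i j : Fin n, (j : ℕ) ≠ (i : ℕ) → (j : ℕ) ≠ (i : ℕ) + 1 → A i j = 0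

/-- The `k`-th least singular value (`1 ≤ k ≤ n`, counted with multiplicity) of an `n × n` matrix.
Mathlib's sequence of singular values is decreasing and starts at index `0`. -/
noncomputable def kthLeastSingularValue {n : ℕ} (A : Matrix (Fin n) (Fin n) ℝ) (k : ℕ) : ℝ :=
  (Matrix.toEuclideanLin A).singularValues (n - k)

/-! ### The zero temperature Laguerre model and its scaling at the hard edge -/

/-- The `n × n` matrix `L^{∞,a}`: diagonal `√(a+n), √(a+n-1), …, √(a+1)` and superdiagonal
`√(n-1), √(n-2), …, √1`. -/
noncomputable def laguerreInf (a : ℝ) (n : ℕ) : Matrix (Fin n) (Fin n) ℝ :=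
  Matrix.of fun i j =>
    if (j : ℕ) = (i : ℕ) then √(a + n - (i : ℕ))
    else if (j : ℕ) = (i : ℕ) + 1 then √((n : ℝ) - 1 - (i : ℕ)) else 0

/-- The mesh size `h = 1 / (2n + a + 1)`. -/
noncomputable def meshSize (a : ℝ) (n : ℕ) : ℝ := 1 / (2 * n + a + 1)

/-- The grid point `x_i = h (a + i)`. -/
noncomputable def meshPoint (a : ℝ) (n i : ℕ) : ℝ := meshSize a n * (a + i)

/-- `L_hard^{∞,a} = √(2/h) F Ω (L^{∞,a})ᵀ Ω F`. -/
noncomputable def laguerreHard (a : ℝ) (n : ℕ) : Matrix (Fin n) (Fin n) ℝ :=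
  √(2 / meshSize a n) •
    (flipMatrix n * omegaMatrix n * (laguerreInf a n).transpose * omegaMatrix n * flipMatrix n)

/-- The finite difference discretization
`-2 diag(√x₂, √x₄, …, √x₂ₙ) (1/(2h) ∇) + a diag(1/√x₂, 1/√x₄, …, 1/√x₂ₙ) S`. -/
noncomputable def besselDiscretization (a : ℝ) (n : ℕ) : Matrix (Fin n) (Fin n) ℝ :=
  (-2 : ℝ) • (Matrix.diagonal (fun i : Fin n => √(meshPoint a n (2 * ((i : ℕ) + 1)))) *
      ((1 / (2 * meshSize a n)) • nablaMatrix n n)) +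
    a • (Matrix.diagonal (fun i : Fin n => 1 / √(meshPoint a n (2 * ((i : ℕ) + 1)))) *
      interpMatrix n n)

/-! ### Bessel functions and the classical Bessel operator -/

/-- The Bessel function of the first kind of real order `a`, for positive argument. -/
noncomputable def besselJ (a t : ℝ) : ℝ :=
  ∑' m : ℕ, (-1) ^ m / ((m.factorial : ℝ) * Real.Gamma (m + a + 1)) * (t / 2) ^ (2 * (m : ℝ) + a)

/-- The action of the Bessel operator: `v ↦ -2 √x v' + (a / √x) v`. -/
noncomputable def besselAction (a : ℝ) (v : ℝ → ℝ) (x : ℝ) : ℝ :=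
  -2 * √x * deriv v x + a / √x * v x

/-- The domain in `L²(0,1)` of the classical Bessel operator `𝒥_a` with type (i) boundary
conditions `v(1) = 0` and `(𝒥_a v)(0) = 0`. -/
structure InBesselDomain (a : ℝ) (v : ℝ → ℝ) : Prop where
  differentiable : DifferentiableOn ℝ v (Ioo 0 1)
  memLp : MemLp v 2 (volume.restrict (Ioo 0 1))
  memLp_action : MemLp (besselAction a v) 2 (volume.restrict (Ioo 0 1))
  at_one : Tendsto v (𝓝[<] 1) (𝓝 0)
  action_at_zero : Tendsto (besselAction a v) (𝓝[>] 0) (𝓝 0)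

/-- `u` lies in the domain of the `L²(0,1)` adjoint of `𝒥_a` (with type (i) boundary conditions),
and the adjoint maps `u` to `w`. -/
structure IsBesselAdjoint (a : ℝ) (u w : ℝ → ℝ) : Prop where
  memLp_left : MemLp u 2 (volume.restrict (Ioo 0 1))
  memLp_right : MemLp w 2 (volume.restrict (Ioo 0 1))
  integral_eq : ∀ φ : ℝ → ℝ, InBesselDomain a φ →
    ∫ x in Ioo (0 : ℝ) 1, besselAction a φ x * u x = ∫ x in Ioo (0 : ℝ) 1, φ x * w x

/-- `v` and `u` are a right and a left singular function of `𝒥_a` (type (i) boundary conditions)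
for `σ`: `𝒥_a v = σ u`, `𝒥_a^* u = σ v`, where `v` is in the domain and is not the zero
function. -/
structure IsBesselSingularPair (a σ : ℝ) (v u : ℝ → ℝ) : Prop where
  domain : InBesselDomain a v
  ne_zero : ∃ x ∈ Ioo (0 : ℝ) 1, v x ≠ 0
  action_eq : ∀ x ∈ Ioo (0 : ℝ) 1, besselAction a v x = σ * u x
  adjoint_eq : IsBesselAdjoint a u (fun x => σ * v x)

/-- The set of singular values of `𝒥_a` with type (i) boundary conditions. -/
def besselSingularValues (a : ℝ) : Set ℝ :=
  {σ | 0 ≤ σ ∧ ∃ v u : ℝ → ℝ, IsBesselSingularPair a σ v u}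

/-- `s` is the `k`-th least element of `A` (`k = 1` for the least one). -/
def IsKthLeast (A : Set ℝ) (k : ℕ) (s : ℝ) : Prop :=
  s ∈ A ∧ (A ∩ Iic s).encard = k

/-!
The substitution `v = x^(a/2) q`, `P = ∫₀ˣ y^a q` turns the singular value problem of the Bessel
operator into the system `q' = -κ x^(-a-1) P`, `P' = x^a q` with `κ = σ²/4`, whose solution regular
at `0` is `q(x) = f(κ x)`, where `f = ₀F₁(; a + 1; -z)` is the Bessel function of order `a` up to a
power of `t` and the change of variable `z = t²/4`.

*The operator.* The adjoint equation is tested on the functions `φ` with `𝒥_a φ = ψ` for arbitrary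
test functions `ψ`; this identifies the left singular function with a multiple of
`x^(-(a+1)/2) P` (`IsBesselAdjoint.ae_eq`). The Wronskian with the regular solution is constant, and
it vanishes at `0` because otherwise `x^(a/2) v` would not be integrable there
(`exists_eq_mul_regularSolution`). Hence `v` is a multiple of `x^(a/2) f(σ² x / 4)`, and the
condition `v(1) = 0` says that `σ` is a zero of the Bessel function. Conversely each positive zero
yields a singular pair by Green's formula (`isBesselAdjoint_leftSingularFunction`).

*The matrices.* The coordinates of an eigenvector of `AᵀA`, `A = L_hard^{∞,a}`, satisfy the
three-term recurrence of Laguerre polynomials, and the last row forces the value at index `n` to be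
zero (`eigenvector_eq_laguerreNormalized`). So the eigenvalues are simple and are the zeros of the
scaled polynomial `g_n(z) = ₁F₁(-n; a + 1; 2 h z)`, `z = σ²/4`.

*The limit.* By dominated convergence `g_n` and `g_n'` converge continuously to `f` and `f'`
(`tendsto_laguerreNormalized`). The positive zeros of `f` are simple, infinite in number (Sturm
comparison) and finite in number on bounded intervals. A sign change produces a zero of `g_n` near
each zero of `f`, and since all eigenvalues are real, Rolle's theorem and compactness exclude further
ones: two zeros of `g_n` that merge would produce a double zero of `f`. So the `k`-th zeros
converge (`tendsto_of_isKthLeast`).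

*The error matrix* is the remainder of the first-order Taylor expansion of the square root.
-/

/-! ### The hypergeometric limit function -/

/-- The rising factorial `(b)_k = b (b + 1) ⋯ (b + k - 1)`. -/
noncomputable def risingFactorial (b : ℝ) (k : ℕ) : ℝ := (ascPochhammer ℝ k).eval b

/-- The confluent hypergeometric limit function `₀F₁(; b; -z) = ∑ (-z)^k / (k! (b)_k)`. The Bessel
function of order `b - 1` is, up to a power of its argument, this function at `z = t² / 4`. -/
noncomputable def hypLimit (b z : ℝ) : ℝ :=
  ∑' k : ℕ, (-1) ^ k / risingFactorial b k * (z ^ k / (k.factorial : ℝ))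

/-- The Laguerre polynomial of degree `n` and order `b - 1`, normalized to take the value `1`
at `0`: this is `₁F₁(-n; b; x)`. -/
noncomputable def laguerreNormalized (b : ℝ) (n : ℕ) (x : ℝ) : ℝ :=
  ∑ k ∈ Finset.range (n + 1), (-1) ^ k / risingFactorial b k * ((n.choose k : ℝ) * x ^ k)

lemma risingFactorial_pos {b : ℝ} (hb : 0 < b) (k : ℕ) : 0 < risingFactorial b k :=
  ascPochhammer_pos k b hb

lemma risingFactorial_succ (b : ℝ) (k : ℕ) :
    risingFactorial b (k + 1) = risingFactorial b k * (b + k) :=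
  ascPochhammer_succ_eval k b

lemma risingFactorial_succ_left (b : ℝ) (k : ℕ) :
    risingFactorial b (k + 1) = b * risingFactorial (b + 1) k := by
  simp [risingFactorial, ascPochhammer_succ_left]

lemma inv_risingFactorial_le {b : ℝ} (hb : 0 < b) (k : ℕ) :
    1 / risingFactorial b k ≤ 1 + 1 / b := by
  have hb' : 0 < 1 / b := by positivity
  cases k with
  | zero => simp [risingFactorial]; positivity
  | succ k =>
    have h1 : ∀ k : ℕ, 1 ≤ risingFactorial (b + 1) k := by
      intro k
      induction k with
      | zero => simp [risingFactorial]
      | succ k ih =>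
        rw [risingFactorial_succ]
        have : (1 : ℝ) ≤ b + 1 + k := by
          have : (0 : ℝ) ≤ k := Nat.cast_nonneg k
          linarith
        nlinarith
    rw [risingFactorial_succ_left]
    have : 1 / (b * risingFactorial (b + 1) k) ≤ 1 / b :=
      one_div_le_one_div_of_le hb (le_mul_of_one_le_right hb.le (h1 k))
    linarith

lemma abs_coeff_le {b : ℝ} (hb : 0 < b) (k : ℕ) :
    |(-1) ^ k / risingFactorial b k| ≤ 1 + 1 / b := by
  rw [abs_div, abs_pow, abs_neg, abs_one, one_pow, abs_of_pos (risingFactorial_pos hb k)]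
  exact inv_risingFactorial_le hb k

lemma summable_majorant (b R : ℝ) :
    Summable fun k : ℕ => (1 + 1 / b) * (R ^ k / (k.factorial : ℝ)) :=
  (Real.summable_pow_div_factorial R).mul_left _

lemma norm_hypLimit_term_le {b : ℝ} (hb : 0 < b) {z R : ℝ} (hz : |z| ≤ R) (k : ℕ) :
    ‖(-1) ^ k / risingFactorial b k * (z ^ k / (k.factorial : ℝ))‖
      ≤ (1 + 1 / b) * (R ^ k / (k.factorial : ℝ)) := by
  rw [Real.norm_eq_abs, abs_mul]
  have h1 := abs_coeff_le hb k
  have h2 : |z ^ k / (k.factorial : ℝ)| ≤ R ^ k / (k.factorial : ℝ) := by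
    rw [abs_div, abs_pow, Nat.abs_cast]
    gcongr
  have : 0 ≤ 1 + 1 / b := by positivity
  gcongr

lemma summable_hypLimit {b : ℝ} (hb : 0 < b) (z : ℝ) :
    Summable fun k : ℕ => (-1) ^ k / risingFactorial b k * (z ^ k / (k.factorial : ℝ)) :=
  .of_norm_bounded (summable_majorant b |z|) (norm_hypLimit_term_le hb le_rfl)

lemma hypLimit_zero (b : ℝ) : hypLimit b 0 = 1 := by
  unfold hypLimit
  rw [tsum_eq_single 0]
  · simp [risingFactorial]
  · intro k hk
    simp [hk]

lemma laguerreNormalized_zero_right (b : ℝ) (n : ℕ) : laguerreNormalized b n 0 = 1 := by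
  unfold laguerreNormalized
  rw [Finset.sum_eq_single 0]
  · simp [risingFactorial]
  · intro k _ hk
    simp [hk]
  · simp

lemma laguerreNormalized_zero (b x : ℝ) : laguerreNormalized b 0 x = 1 := by
  simp [laguerreNormalized, risingFactorial]

lemma summable_nat_mul_pow_pred_div_factorial (R : ℝ) :
    Summable fun k : ℕ => (k : ℝ) * R ^ (k - 1) / (k.factorial : ℝ) := by
  rw [← summable_nat_add_iff 1]
  refine (Real.summable_pow_div_factorial R).congr fun k => ?_
  rw [Nat.factorial_succ]
  have : (k.factorial : ℝ) ≠ 0 := by positivity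
  push_cast
  field_simp

lemma hasDerivAt_hypLimit {b : ℝ} (hb : 0 < b) (z : ℝ) :
    HasDerivAt (hypLimit b) (-hypLimit (b + 1) z / b) z := by
  have key : HasDerivAt (fun z => ∑' k : ℕ, (-1) ^ k / risingFactorial b k *
      (z ^ k / (k.factorial : ℝ)))
      (∑' k : ℕ, (-1) ^ k / risingFactorial b k * (k * z ^ (k - 1) / (k.factorial : ℝ))) z := by
    refine hasDerivAt_tsum_of_isPreconnected
      (g := fun (k : ℕ) (z : ℝ) => (-1) ^ k / risingFactorial b k * (z ^ k / (k.factorial : ℝ)))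
      (g' := fun (k : ℕ) (z : ℝ) =>
        (-1) ^ k / risingFactorial b k * (k * z ^ (k - 1) / (k.factorial : ℝ)))
      (u := fun k : ℕ => (1 + 1 / b) * (k * (|z| + 1) ^ (k - 1) / (k.factorial : ℝ)))
      (t := Ioo (-(|z| + 1)) (|z| + 1)) (y₀ := z) ?_ isOpen_Ioo isPreconnected_Ioo ?_ ?_ ?_
      (summable_hypLimit hb z) ?_
    · exact (summable_nat_mul_pow_pred_div_factorial (|z| + 1)).mul_left (1 + 1 / b)
    · intro k y _
      exact ((hasDerivAt_pow k y).div_const _).const_mul _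
    · intro k y hy
      rw [Real.norm_eq_abs, abs_mul]
      have h1 := abs_coeff_le hb k
      have h2 : |k * y ^ (k - 1) / (k.factorial : ℝ)|
          ≤ k * (|z| + 1) ^ (k - 1) / (k.factorial : ℝ) := by
        rw [abs_div, abs_mul, abs_pow, Nat.abs_cast, Nat.abs_cast]
        have : |y| ≤ |z| + 1 := (abs_lt.2 hy).le
        gcongr
      have : 0 ≤ 1 + 1 / b := by positivity
      gcongr
    · constructor <;> linarith [neg_abs_le z, le_abs_self z]
    · constructor <;> linarith [neg_abs_le z, le_abs_self z]
  refine HasDerivAt.congr_deriv (f := hypLimit b) key ?_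
  have hterm : ∀ k : ℕ, (-1) ^ (k + 1) / risingFactorial b (k + 1) *
      (((k + 1 : ℕ) : ℝ) * z ^ (k + 1 - 1) / ((k + 1).factorial : ℝ)) =
      -1 / b * ((-1) ^ k / risingFactorial (b + 1) k * (z ^ k / (k.factorial : ℝ))) := by
    intro k
    rw [risingFactorial_succ_left, Nat.factorial_succ, Nat.add_sub_cancel]
    have := (risingFactorial_pos (b := b + 1) (by linarith) k).ne'
    have : (k.factorial : ℝ) ≠ 0 := by positivity
    push_cast
    field_simp
    ring
  have hs : Summable fun k : ℕ => (-1) ^ k / risingFactorial b k *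
      (k * z ^ (k - 1) / (k.factorial : ℝ)) := by
    rw [← summable_nat_add_iff 1]
    exact ((summable_hypLimit (b := b + 1) (by linarith) z).mul_left (-1 / b)).congr
      fun k => (hterm k).symm
  rw [hs.tsum_eq_zero_add, tsum_congr hterm, tsum_mul_left]
  simp only [Nat.cast_zero, zero_mul, zero_div, mul_zero, zero_add]
  rw [hypLimit]
  ring

lemma continuous_hypLimit {b : ℝ} (hb : 0 < b) : Continuous (hypLimit b) :=
  continuous_iff_continuousAt.2 fun z => (hasDerivAt_hypLimit hb z).continuousAt

/-- The contiguous relation between the orders `b`, `b + 1` and `b + 2`; it encodes the differential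
equation `z f'' + b f' + f = 0`. -/
lemma hypLimit_contiguous {b : ℝ} (hb : 0 < b) (z : ℝ) :
    z * hypLimit (b + 1 + 1) z = b * (b + 1) * (hypLimit (b + 1) z - hypLimit b z) := by
  have s1 := summable_hypLimit hb z
  have s2 := summable_hypLimit (b := b + 1) (by linarith) z
  have hd := s2.sub s1
  unfold hypLimit
  rw [← s2.tsum_sub s1, hd.tsum_eq_zero_add, ← tsum_mul_left, mul_add, ← tsum_mul_left]
  simp only [risingFactorial, ascPochhammer_zero, Polynomial.eval_one, pow_zero, sub_self, mul_zero,
    zero_add]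
  refine tsum_congr fun k => ?_
  change z * ((-1) ^ k / risingFactorial (b + 1 + 1) k * _) = b * (b + 1) *
    ((-1) ^ (k + 1) / risingFactorial (b + 1) (k + 1) * _ -
      (-1) ^ (k + 1) / risingFactorial b (k + 1) * _)
  have h1 := (risingFactorial_pos (b := b + 1 + 1) (by linarith) k).ne'
  have h2 := (risingFactorial_pos (b := b + 1) (by linarith) k).ne'
  have h3 : (b + 1) * risingFactorial (b + 1 + 1) k = risingFactorial (b + 1) k * (b + 1 + k) := by
    rw [← risingFactorial_succ, risingFactorial_succ_left]
  have h4 : b + 1 + (k : ℝ) ≠ 0 := by positivity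
  have h5 : risingFactorial (b + 1 + 1) k = risingFactorial (b + 1) k * (b + 1 + k) / (b + 1) := by
    rw [← h3]; field_simp
  rw [risingFactorial_succ_left b, risingFactorial_succ, Nat.factorial_succ, h5]
  have : (k.factorial : ℝ) ≠ 0 := by positivity
  push_cast
  field_simp
  ring

lemma hasDerivAt_hypLimit_succ {b : ℝ} (hb : 0 < b) {z : ℝ} (hz : z ≠ 0) :
    HasDerivAt (hypLimit (b + 1)) (b * (hypLimit b z - hypLimit (b + 1) z) / z) z := by
  convert hasDerivAt_hypLimit (b := b + 1) (by linarith) z using 1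
  have := hypLimit_contiguous hb z
  have h : b + 1 ≠ 0 := by positivity
  field_simp
  linarith

/-- The function `z ↦ z^b (z D² / b² + f² - (b - 1) f D / b)` for `f = ₀F₁(; b; -z)` and
`D = ₀F₁(; b + 1; -z) = -b f'` has the nonnegative derivative `z^(b-1) f²`. Since it vanishes at `0`,
it is positive on `(0, ∞)`, so `f` has no double zero there. -/
lemma hypLimit_succ_ne_zero {b : ℝ} (hb : 0 < b) {s : ℝ} (hs : 0 < s) (h0 : hypLimit b s = 0) :
    hypLimit (b + 1) s ≠ 0 := by
  intro h1
  set G : ℝ → ℝ := fun z => z ^ b * (z * hypLimit (b + 1) z ^ 2 / b ^ 2 + hypLimit b z ^ 2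
    - (b - 1) * (hypLimit b z * hypLimit (b + 1) z) / b) with hG
  have hder : ∀ z, 0 < z → HasDerivAt G (z ^ (b - 1) * hypLimit b z ^ 2) z := by
    intro z hz
    have hf := hasDerivAt_hypLimit hb z
    have hD := hasDerivAt_hypLimit_succ hb hz.ne'
    have hp := Real.hasDerivAt_rpow_const (x := z) (p := b) (Or.inl hz.ne')
    have := hp.mul (((((hasDerivAt_id z).mul (hD.pow 2)).div_const (b ^ 2)).add (hf.pow 2)).sub
      (((hf.mul hD).const_mul (b - 1)).div_const b))
    refine this.congr_deriv ?_
    have e : z ^ b = z * z ^ (b - 1) := by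
      rw [mul_comm, ← Real.rpow_add_one hz.ne']; simp
    simp only [id, Pi.mul_apply, Pi.pow_apply, Pi.add_apply, Pi.sub_apply]
    rw [e]
    field_simp
    simp
    ring
  have hcont : Continuous G := by
    have := continuous_hypLimit hb
    have := continuous_hypLimit (b := b + 1) (by linarith)
    have := Real.continuous_rpow_const hb.le
    fun_prop
  have hG0 : G 0 = 0 := by simp [hG, Real.zero_rpow hb.ne']
  have hGs : G s = 0 := by simp [hG, h0, h1]
  have hmono : MonotoneOn G (Ici 0) := by
    refine monotoneOn_of_deriv_nonneg (convex_Ici 0) hcont.continuousOn ?_ ?_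
    · intro z hz
      rw [interior_Ici] at hz
      exact (hder z hz).differentiableAt.differentiableWithinAt
    · intro z hz
      rw [interior_Ici] at hz
      rw [(hder z hz).deriv]
      exact mul_nonneg (Real.rpow_nonneg hz.le _) (sq_nonneg _)
  have hzero : ∀ z ∈ Ioo 0 s, hypLimit b z = 0 := by
    intro z hz
    have hev : G =ᶠ[𝓝 z] fun _ => 0 := by
      filter_upwards [Ioo_mem_nhds hz.1 hz.2] with y hy
      exact le_antisymm (hGs ▸ hmono hy.1.le hs.le hy.2.le)
        (hG0 ▸ hmono (mem_Ici.2 le_rfl) hy.1.le hy.1.le)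
    have := (hder z hz.1).unique ((hasDerivAt_const z (0 : ℝ)).congr_of_eventuallyEq hev)
    have hne := (Real.rpow_pos_of_pos hz.1 (b - 1)).ne'
    simpa [hne] using this
  have hlim : Tendsto (hypLimit b) (𝓝[>] 0) (𝓝 (hypLimit b 0)) :=
    ((continuous_hypLimit hb).tendsto 0).mono_left nhdsWithin_le_nhds
  have hlim' : Tendsto (hypLimit b) (𝓝[>] 0) (𝓝 0) :=
    tendsto_const_nhds.congr' <| by
      filter_upwards [Ioo_mem_nhdsGT hs] with z hz using (hzero z hz).symm
  have := tendsto_nhds_unique hlim hlim'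
  rw [hypLimit_zero] at this
  exact one_ne_zero this

/-! ### Zeros of the limit function and Laguerre polynomials -/

lemma finite_zeros_hypLimit {b : ℝ} (hb : 0 < b) (R : ℝ) :
    ({z : ℝ | 0 < z ∧ hypLimit b z = 0} ∩ Iic R).Finite := by
  by_contra hinf
  have hsub : {z : ℝ | 0 < z ∧ hypLimit b z = 0} ∩ Iic R ⊆ Icc 0 R :=
    fun z hz => ⟨hz.1.1.le, hz.2⟩
  obtain ⟨x, hx, hacc⟩ := Set.Infinite.exists_accPt_of_subset_isCompact hinf isCompact_Icc hsub
  have hfreq := accPt_iff_frequently_nhdsNE.1 hacc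
  have hx0 : hypLimit b x = 0 := by
    have hcl : IsClosed {z | hypLimit b z = 0} :=
      isClosed_eq (continuous_hypLimit hb) continuous_const
    refine hcl.mem_of_frequently_of_tendsto (hfreq.mono fun y hy => hy.1.2)
      (tendsto_id.mono_left nhdsWithin_le_nhds)
  have hxpos : 0 < x := by
    refine lt_of_le_of_ne hx.1 fun h => ?_
    rw [← h, hypLimit_zero] at hx0
    exact one_ne_zero hx0
  have hne := (hasDerivAt_hypLimit hb x).eventually_ne (c := 0)
    (div_ne_zero (neg_ne_zero.2 (hypLimit_succ_ne_zero hb hxpos hx0)) hb.ne')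
  obtain ⟨y, hy, hy'⟩ := (hfreq.and_eventually hne).exists
  exact hy' hy.1.2

/-- Sturm comparison with `sin ((t - t₀) / 2)`: a solution of the first-order form of
`w'' = -(1 - (m² - m) / t²) w` cannot stay positive on an interval of length `2π` that lies far
enough to the right. -/
lemma not_forall_pos_of_oscillating {m t₀ : ℝ} {w e : ℝ → ℝ} (ht₀ : 0 < t₀)
    (hm : m ^ 2 - m < 3 / 4 * t₀ ^ 2) (hw : ∀ t, 0 < t → HasDerivAt w (m / t * w t - e t) t)
    (he : ∀ t, 0 < t → HasDerivAt e (w t - m / t * e t) t) :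
    ¬ ∀ t ∈ Icc t₀ (t₀ + 2 * Real.pi), 0 < w t := by
  intro hpos
  have hpi := Real.pi_pos
  set W : ℝ → ℝ := fun t => (m / t * w t - e t) * Real.sin ((t - t₀) / 2)
    - w t * (Real.cos ((t - t₀) / 2) / 2) with hW
  have hder : ∀ t, 0 < t →
      HasDerivAt W (((m ^ 2 - m) / t ^ 2 - 3 / 4) * w t * Real.sin ((t - t₀) / 2)) t := by
    intro t ht
    have hl : HasDerivAt (fun t : ℝ => (t - t₀) / 2) (1 / 2) t :=
      ((hasDerivAt_id t).sub_const t₀).div_const 2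
    have hmt : HasDerivAt (fun t : ℝ => m / t) (-m / t ^ 2) t := by
      refine ((hasDerivAt_const t m).fun_div (hasDerivAt_id' t) ht.ne').congr_deriv ?_
      ring
    have := (((hmt.mul (hw t ht)).sub (he t ht)).mul hl.sin).sub
      ((hw t ht).mul (hl.cos.div_const 2))
    refine this.congr_deriv ?_
    simp only [Pi.mul_apply, Pi.sub_apply]
    field_simp
    ring
  have hanti : AntitoneOn W (Icc t₀ (t₀ + 2 * Real.pi)) := by
    refine antitoneOn_of_deriv_nonpos (convex_Icc _ _) ?_ ?_ ?_
    · exact fun t ht => (hder t (ht₀.trans_le ht.1)).continuousAt.continuousWithinAt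
    · intro t ht
      rw [interior_Icc] at ht
      exact (hder t (ht₀.trans ht.1)).differentiableAt.differentiableWithinAt
    · intro t ht
      rw [interior_Icc] at ht
      have ht0 := ht₀.trans ht.1
      rw [(hder t ht0).deriv]
      have h1 : (m ^ 2 - m) / t ^ 2 - 3 / 4 ≤ 0 := by
        rw [sub_nonpos, div_le_iff₀ (by positivity)]
        nlinarith [ht.1]
      have h2 : 0 ≤ Real.sin ((t - t₀) / 2) :=
        Real.sin_nonneg_of_nonneg_of_le_pi (by linarith [ht.1]) (by linarith [ht.2])
      exact mul_nonpos_of_nonpos_of_nonneg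
        (mul_nonpos_of_nonpos_of_nonneg h1 (hpos t ⟨ht.1.le, ht.2.le⟩).le) h2
  -- The Wronskian is negative at the left end and positive at the right end of the interval.
  have hl : t₀ ∈ Icc t₀ (t₀ + 2 * Real.pi) := ⟨le_rfl, by linarith⟩
  have hr : t₀ + 2 * Real.pi ∈ Icc t₀ (t₀ + 2 * Real.pi) := ⟨by linarith, le_rfl⟩
  have hle := hanti hl hr hr.1
  have e1 : (t₀ + 2 * Real.pi - t₀) / 2 = Real.pi := by ring
  have h1 := hpos _ hl
  have h2 := hpos _ hr
  simp only [hW, e1, sub_self, zero_div, Real.sin_zero, Real.cos_zero, Real.sin_pi, Real.cos_pi,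
    mul_zero] at hle
  linarith

/-- With `w = t^(a + 1/2) f(t²/4)`, a multiple of `√t` times the Bessel function, the equation for
`f` becomes a perturbation of `w'' = -w`, which oscillates. -/
lemma exists_zero_hypLimit_gt {b : ℝ} (hb : 0 < b) (T : ℝ) :
    ∃ z, 0 < z ∧ T < z ∧ hypLimit b z = 0 := by
  by_contra! hcon
  set m : ℝ := b - 1 / 2 with hm
  set w : ℝ → ℝ := fun t => t ^ m * hypLimit b (t ^ 2 / 4) with hw
  set e : ℝ → ℝ := fun t => t ^ (m + 1) * hypLimit (b + 1) (t ^ 2 / 4) / (2 * b) with he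
  have hsq : ∀ t : ℝ, HasDerivAt (fun t : ℝ => t ^ 2 / 4) (t / 2) t := by
    intro t
    refine ((hasDerivAt_pow 2 t).div_const 4).congr_deriv ?_
    norm_num
    ring
  have hw' : ∀ t, 0 < t → HasDerivAt w (m / t * w t - e t) t := by
    intro t ht
    have hf := (hasDerivAt_hypLimit hb (t ^ 2 / 4)).comp t (hsq t)
    have hp := Real.hasDerivAt_rpow_const (x := t) (p := m) (Or.inl ht.ne')
    refine (hp.mul hf).congr_deriv ?_
    simp only [hw, he, Function.comp_apply, Real.rpow_sub_one ht.ne', Real.rpow_add_one ht.ne']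
    field_simp
    ring
  have he' : ∀ t, 0 < t → HasDerivAt e (w t - m / t * e t) t := by
    intro t ht
    have hf := (hasDerivAt_hypLimit_succ hb (z := t ^ 2 / 4) (by positivity)).comp t (hsq t)
    have hp := Real.hasDerivAt_rpow_const (x := t) (p := m + 1) (Or.inl ht.ne')
    refine ((hp.mul hf).div_const (2 * b)).congr_deriv ?_
    simp only [hw, he, Function.comp_apply, Real.rpow_sub_one ht.ne', Real.rpow_add_one ht.ne']
    field_simp
    rw [hm]
    ring
  -- Far enough to the right for `m² - m < 3 t₀² / 4` and for `t² / 4 > T` on `[t₀, ∞)`.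
  set t₀ : ℝ := 2 + 2 * |T| + 2 * |m ^ 2 - m| with ht₀
  have habs1 := abs_nonneg T
  have habs2 := abs_nonneg (m ^ 2 - m)
  have hpos : 0 < t₀ := by positivity
  have hsmall : m ^ 2 - m < 3 / 4 * t₀ ^ 2 := by
    have := le_abs_self (m ^ 2 - m)
    nlinarith
  have hne : ∀ t ∈ Ici t₀, w t ≠ 0 := by
    intro t ht
    have ht' : t₀ ≤ t := ht
    have htp : 0 < t := hpos.trans_le ht
    refine mul_ne_zero (Real.rpow_pos_of_pos htp _).ne' (hcon _ (by positivity) ?_)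
    have := le_abs_self T
    nlinarith
  have hcont : ContinuousOn w (Ici t₀) := fun t ht =>
    (hw' t (hpos.trans_le ht)).continuousAt.continuousWithinAt
  -- Without zeros `w` has a constant sign on `[t₀, ∞)`.
  rcases lt_or_gt_of_ne (hne t₀ self_mem_Ici) with hs | hs
  · refine not_forall_pos_of_oscillating (w := fun t => -w t) (e := fun t => -e t) hpos hsmall
      (fun t ht => (hw' t ht).neg.congr_deriv (by ring))
      (fun t ht => (he' t ht).neg.congr_deriv (by ring)) fun t ht => ?_
    by_contra hle
    have hmem : (0 : ℝ) ∈ Icc (w t₀) (w t) := ⟨hs.le, by linarith⟩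
    obtain ⟨y, hy, hy0⟩ := intermediate_value_Icc ht.1
      (hcont.mono Icc_subset_Ici_self) hmem
    exact hne y hy.1 hy0
  · refine not_forall_pos_of_oscillating hpos hsmall hw' he' fun t ht => ?_
    by_contra hle
    have hmem : (0 : ℝ) ∈ Icc (w t) (w t₀) := ⟨by linarith, hs.le⟩
    obtain ⟨y, hy, hy0⟩ := intermediate_value_Icc' ht.1
      (hcont.mono Icc_subset_Ici_self) hmem
    exact hne y hy.1 hy0

lemma infinite_zeros_hypLimit {b : ℝ} (hb : 0 < b) :
    {z : ℝ | 0 < z ∧ hypLimit b z = 0}.Infinite := by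
  refine infinite_of_forall_exists_gt fun T => ?_
  obtain ⟨z, h1, h2, h3⟩ := exists_zero_hypLimit_gt hb T
  exact ⟨z, ⟨h1, h3⟩, h2⟩

lemma laguerreNormalized_eq_tsum (b : ℝ) (n : ℕ) (x : ℝ) :
    laguerreNormalized b n x =
      ∑' k : ℕ, (-1) ^ k / risingFactorial b k * ((n.choose k : ℝ) * x ^ k) := by
  rw [tsum_eq_sum (s := Finset.range (n + 1))]
  · rfl
  · intro k hk
    rw [Nat.choose_eq_zero_of_lt (by simpa using hk)]
    simp

/-- The Mehler–Heine limit of Laguerre polynomials, in the form of continuous convergence: if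
`n → ∞` and `n x → z`, then `₁F₁(-n; b; x) → ₀F₁(; b; -z)`. -/
lemma tendsto_laguerreNormalized {b : ℝ} (hb : 0 < b) {ι : Type*} {l : Filter ι} {N : ι → ℕ}
    {y : ι → ℝ} {z : ℝ} (hN : Tendsto N l atTop) (hy : Tendsto (fun i => (N i : ℝ) * y i) l (𝓝 z)) :
    Tendsto (fun i => laguerreNormalized b (N i) (y i)) l (𝓝 (hypLimit b z)) := by
  simp only [laguerreNormalized_eq_tsum]
  refine tendsto_tsum_of_dominated_convergence (summable_majorant b (|z| + 1)) ?_ ?_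
  · intro k
    refine Tendsto.const_mul _ ?_
    have h1 : Tendsto (fun n : ℕ => (n.choose k : ℝ) / (n : ℝ) ^ k) atTop
        (𝓝 (1 / (k.factorial : ℝ))) := by
      have := (isEquivalent_choose k).div
        (Asymptotics.IsEquivalent.refl (u := fun n : ℕ => (n : ℝ) ^ k) (l := atTop))
      refine this.symm.tendsto_nhds (tendsto_const_nhds.congr' ?_)
      filter_upwards [eventually_gt_atTop 0] with n hn
      have : (n : ℝ) ≠ 0 := by positivity
      have : (k.factorial : ℝ) ≠ 0 := by positivity
      simp only [Pi.div_apply]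
      field_simp
    have h2 := (h1.comp hN).mul (hy.pow k)
    rw [one_div, inv_mul_eq_div] at h2
    refine h2.congr' ?_
    filter_upwards [hN.eventually_gt_atTop 0] with i hi
    have : (N i : ℝ) ≠ 0 := by positivity
    simp only [Function.comp_apply]
    rw [mul_pow]
    field_simp
  · have hev : ∀ᶠ i in l, |(N i : ℝ) * y i| < |z| + 1 :=
      hy.abs.eventually_lt_const (by linarith)
    filter_upwards [hev] with i hi k
    rw [Real.norm_eq_abs, abs_mul]
    have h1 := abs_coeff_le hb k
    have h2 : |((N i).choose k : ℝ) * y i ^ k| ≤ (|z| + 1) ^ k / (k.factorial : ℝ) := by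
      have hc : ((N i).choose k : ℝ) ≤ (N i : ℝ) ^ k / (k.factorial : ℝ) :=
        Nat.choose_le_pow_div k (N i)
      rw [abs_mul, abs_pow, Nat.abs_cast]
      calc ((N i).choose k : ℝ) * |y i| ^ k
          ≤ (N i : ℝ) ^ k / (k.factorial : ℝ) * |y i| ^ k := by gcongr
        _ = |(N i : ℝ) * y i| ^ k / (k.factorial : ℝ) := by
          rw [abs_mul, Nat.abs_cast, mul_pow]; ring
        _ ≤ _ := by gcongr
    have : 0 ≤ 1 + 1 / b := by positivity
    gcongr

lemma hasDerivAt_laguerreNormalized {b : ℝ} (hb : 0 < b) (n : ℕ) (x : ℝ) :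
    HasDerivAt (laguerreNormalized b (n + 1))
      (-((n + 1 : ℕ) : ℝ) / b * laguerreNormalized (b + 1) n x) x := by
  have key : HasDerivAt (fun x => ∑ k ∈ Finset.range (n + 1 + 1),
      (-1) ^ k / risingFactorial b k * (((n + 1).choose k : ℝ) * x ^ k))
      (∑ k ∈ Finset.range (n + 1 + 1),
        (-1) ^ k / risingFactorial b k * (((n + 1).choose k : ℝ) * (k * x ^ (k - 1)))) x :=
    HasDerivAt.fun_sum fun k _ => ((hasDerivAt_pow k x).const_mul _).const_mul _
  refine HasDerivAt.congr_deriv (f := laguerreNormalized b (n + 1)) key ?_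
  rw [Finset.sum_range_succ', laguerreNormalized, Finset.mul_sum]
  simp only [Nat.cast_zero, zero_mul, mul_zero, add_zero]
  refine Finset.sum_congr rfl fun k _ => ?_
  have hch : ((n + 1 : ℕ) : ℝ) * (n.choose k : ℝ) = ((n + 1).choose (k + 1) : ℝ) * (k + 1 : ℕ) := by
    exact_mod_cast Nat.add_one_mul_choose_eq n k
  rw [risingFactorial_succ_left, Nat.add_sub_cancel]
  have := (risingFactorial_pos (b := b + 1) (by linarith) k).ne'
  calc (-1) ^ (k + 1) / (b * risingFactorial (b + 1) k) *
        (((n + 1).choose (k + 1) : ℝ) * (((k + 1 : ℕ) : ℝ) * x ^ k))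
      = (-1) ^ (k + 1) / (b * risingFactorial (b + 1) k) *
        ((((n + 1).choose (k + 1) : ℝ) * ((k + 1 : ℕ) : ℝ)) * x ^ k) := by ring
    _ = _ := by
      rw [← hch]
      field_simp
      ring

/-- The three-term recurrence of the Laguerre polynomials, as a recurrence for differences. -/
lemma laguerreNormalized_recurrence {b : ℝ} (hb : 0 < b) (n : ℕ) (x : ℝ) :
    (b + (n + 1)) * (laguerreNormalized b (n + 2) x - laguerreNormalized b (n + 1) x) =
      (n + 1) * (laguerreNormalized b (n + 1) x - laguerreNormalized b n x)
        - x * laguerreNormalized b (n + 1) x := by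
  have hext : ∀ m ≤ n + 2, laguerreNormalized b m x = ∑ k ∈ Finset.range (n + 3),
      (-1) ^ k / risingFactorial b k * ((m.choose k : ℝ) * x ^ k) := by
    intro m hm
    rw [laguerreNormalized]
    refine Finset.sum_subset (Finset.range_mono (by omega)) fun k _ hk => ?_
    rw [Nat.choose_eq_zero_of_lt (by simpa using hk)]
    simp
  have hshift : x * laguerreNormalized b (n + 1) x = ∑ k ∈ Finset.range (n + 2),
      (-1) ^ k / risingFactorial b k * (((n + 1).choose k : ℝ) * x ^ (k + 1)) := by
    rw [laguerreNormalized, Finset.mul_sum]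
    exact Finset.sum_congr rfl fun k _ => by ring
  rw [hshift, hext (n + 2) le_rfl, hext (n + 1) (by omega), hext n (by omega),
    ← Finset.sum_sub_distrib, ← Finset.sum_sub_distrib, Finset.sum_range_succ',
    Finset.sum_range_succ' _ (n + 2)]
  simp only [Nat.choose_zero_right, sub_self, add_zero, Finset.mul_sum]
  rw [← Finset.sum_sub_distrib]
  refine Finset.sum_congr rfl fun k _ => ?_
  have h1 : ((n + 2).choose (k + 1) : ℝ) = (n + 1).choose k + (n + 1).choose (k + 1) := by
    exact_mod_cast Nat.choose_succ_succ (n + 1) k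
  have h2 : ((n + 1).choose (k + 1) : ℝ) = n.choose k + n.choose (k + 1) := by
    exact_mod_cast Nat.choose_succ_succ n k
  have h3 : ((n + 1 : ℕ) : ℝ) * (n.choose k : ℝ) = ((n + 1).choose (k + 1) : ℝ) * (k + 1 : ℕ) := by
    exact_mod_cast Nat.add_one_mul_choose_eq n k
  have h4 : ((n + 1).choose (k + 1) : ℝ) * (k + 1 : ℕ)
      = ((n + 1).choose k : ℝ) * ((n + 1 : ℝ) - k) := by
    rcases le_or_gt k (n + 1) with hk | hk
    · have := Nat.choose_succ_right_eq (n + 1) k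
      have h5 : (((n + 1 - k : ℕ)) : ℝ) = (n + 1 : ℝ) - k := by
        rw [Nat.cast_sub hk]; push_cast; ring
      rw [← h5]
      exact_mod_cast this
    · rw [Nat.choose_eq_zero_of_lt hk, Nat.choose_eq_zero_of_lt (by omega)]
      simp
  have hr := (risingFactorial_pos hb k).ne'
  have hbk : b + (k : ℝ) ≠ 0 := by positivity
  rw [risingFactorial_succ]
  have e1 : (-1 : ℝ) ^ (k + 1) / (risingFactorial b k * (b + k)) *
      (((n + 2).choose (k + 1) : ℝ) * x ^ (k + 1)) - (-1) ^ (k + 1) /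
      (risingFactorial b k * (b + k)) * (((n + 1).choose (k + 1) : ℝ) * x ^ (k + 1)) =
      (-1) ^ (k + 1) / (risingFactorial b k * (b + k)) * (((n + 1).choose k : ℝ) * x ^ (k + 1)) := by
    rw [h1]; ring
  have e2 : (-1 : ℝ) ^ (k + 1) / (risingFactorial b k * (b + k)) *
      (((n + 1).choose (k + 1) : ℝ) * x ^ (k + 1)) - (-1) ^ (k + 1) /
      (risingFactorial b k * (b + k)) * ((n.choose (k + 1) : ℝ) * x ^ (k + 1)) =
      (-1) ^ (k + 1) / (risingFactorial b k * (b + k)) * ((n.choose k : ℝ) * x ^ (k + 1)) := by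
    rw [h2]; ring
  rw [e1, e2]
  have e3 : ((n : ℝ) + 1) * (n.choose k : ℝ) = ((n + 1).choose k : ℝ) * ((n + 1 : ℝ) - k) := by
    rw [← h4, ← h3]; push_cast; ring
  have e4 : ((n : ℝ) + 1) * ((-1) ^ (k + 1) / (risingFactorial b k * (b + k)) *
      ((n.choose k : ℝ) * x ^ (k + 1))) = (-1) ^ (k + 1) / (risingFactorial b k * (b + k)) *
      ((((n : ℝ) + 1) * (n.choose k : ℝ)) * x ^ (k + 1)) := by ring
  rw [e4, e3]
  field_simp
  ring

lemma laguerreNormalized_one (b x : ℝ) (hb : b ≠ 0) :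
    b * (laguerreNormalized b 1 x - 1) = -x := by
  simp [laguerreNormalized, Finset.sum_range_succ, risingFactorial]
  field_simp

/-! ### Convergence of the least zeros -/

lemma exists_isKthLeast {A : Set ℝ} (hinf : A.Infinite) (hfin : ∀ R, (A ∩ Iic R).Finite) {k : ℕ}
    (hk : 1 ≤ k) : ∃ s, IsKthLeast A k s := by
  -- The least element of `A` beyond a finite initial segment.
  have hnext : ∀ B : Set ℝ, B ⊆ A → B.Finite → ∃ s ∈ A \ B, ∀ x ∈ A \ B, s ≤ x := by
    intro B _ hB
    obtain ⟨y, hy⟩ := (hinf.sdiff hB).nonempty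
    obtain ⟨s, hs, hmin⟩ := ((hfin y).subset (inter_subset_inter_left _ sdiff_subset) :
      ((A \ B) ∩ Iic y).Finite).exists_minimalFor id _ ⟨y, hy, self_mem_Iic⟩
    refine ⟨s, hs.1, fun x hx => ?_⟩
    rcases le_or_gt x y with h | h
    · by_contra hlt
      exact hlt (hmin ⟨hx, h⟩ (not_le.1 hlt).le)
    · exact (mem_Iic.1 hs.2).trans h.le
  induction k, hk using Nat.le_induction with
  | base =>
    obtain ⟨s, hs, hmin⟩ := hnext ∅ (empty_subset _) finite_empty
    simp only [sdiff_empty] at hs hmin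
    refine ⟨s, hs, ?_⟩
    have : A ∩ Iic s = {s} := by
      ext x
      exact ⟨fun hx => le_antisymm hx.2 (hmin x hx.1), fun hx => by rw [hx]; exact ⟨hs, self_mem_Iic⟩⟩
    simp [this]
  | succ k _ ih =>
    obtain ⟨r, hr, hcard⟩ := ih
    obtain ⟨s, hs, hmin⟩ := hnext (A ∩ Iic r) inter_subset_left (hfin r)
    have hrs : r < s := lt_of_not_ge fun h => hs.2 ⟨hs.1, h⟩
    refine ⟨s, hs.1, ?_⟩
    have : A ∩ Iic s = insert s (A ∩ Iic r) := by
      ext x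
      constructor
      · intro hx
        by_cases hxr : x ≤ r
        · exact Or.inr ⟨hx.1, hxr⟩
        · exact Or.inl (le_antisymm hx.2 (hmin x ⟨hx.1, fun h => hxr h.2⟩))
      · rintro (hx | hx)
        · rw [hx]; exact ⟨hs.1, self_mem_Iic⟩
        · exact ⟨hx.1, (mem_Iic.1 hx.2).trans hrs.le⟩
    rw [this, encard_insert_of_notMem hs.2, hcard]
    norm_cast

lemma IsKthLeast.preimage {A : Set ℝ} {k : ℕ} {s : ℝ} (hs : IsKthLeast A k s) {f g : ℝ → ℝ}
    {U : Set ℝ} (hf : StrictMonoOn f U) (hg : ∀ x ∈ A, g x ∈ U ∧ f (g x) = x) :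
    IsKthLeast {t | t ∈ U ∧ f t ∈ A} k (g s) := by
  refine ⟨⟨(hg s hs.1).1, by rw [(hg s hs.1).2]; exact hs.1⟩, ?_⟩
  rw [← hs.2]
  have himg : f '' ({t | t ∈ U ∧ f t ∈ A} ∩ Iic (g s)) = A ∩ Iic s := by
    ext x
    constructor
    · rintro ⟨t, ⟨⟨htU, htA⟩, hts⟩, rfl⟩
      refine ⟨htA, ?_⟩
      have := hf.monotoneOn htU (hg s hs.1).1 hts
      rwa [(hg s hs.1).2] at this
    · rintro ⟨hxA, hxs⟩
      refine ⟨g x, ⟨⟨(hg x hxA).1, by rw [(hg x hxA).2]; exact hxA⟩, ?_⟩, (hg x hxA).2⟩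
      rw [mem_Iic, ← hf.le_iff_le (hg x hxA).1 (hg s hs.1).1, (hg x hxA).2, (hg s hs.1).2]
      exact hxs
  rw [← himg, InjOn.encard_image]
  exact hf.injOn.mono fun t ht => ht.1.1

/-- The `k`-th least elements converge if every point of the limit set is a limit of points, and no
initial segment gains points in the limit. -/
lemma tendsto_of_isKthLeast {A : Set ℝ} {B : ℕ → Set ℝ} {k : ℕ} {s : ℝ} {t : ℕ → ℝ}
    (hA : IsKthLeast A k s) (hB : ∀ᶠ n in atTop, IsKthLeast (B n) k (t n))
    (happrox : ∀ ζ ∈ A, ∀ δ > 0, ∀ᶠ n in atTop, ∃ y ∈ B n, |y - ζ| < δ)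
    (hcount : ∀ R, ∀ᶠ n in atTop, (B n ∩ Iic R).encard ≤ (A ∩ Iic R).encard) :
    Tendsto t atTop (𝓝 s) := by
  have hfin : (A ∩ Iic s).Finite := finite_of_encard_eq_coe hA.2
  refine tendsto_order.2 ⟨fun R hR => ?_, fun R hR => ?_⟩
  · have hlt : (A ∩ Iic R).encard < k := by
      rw [← hA.2]
      refine (hfin.subset (inter_subset_inter_right _ (Iic_subset_Iic.2 hR.le))).encard_lt_encard
        ⟨inter_subset_inter_right _ (Iic_subset_Iic.2 hR.le), fun h => ?_⟩
      exact absurd (mem_Iic.1 (h ⟨hA.1, self_mem_Iic⟩).2) (not_le.2 hR)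
    filter_upwards [hB, hcount R] with n hn hc
    by_contra hle
    have : (B n ∩ Iic (t n)).encard ≤ (B n ∩ Iic R).encard :=
      encard_le_encard (inter_subset_inter_right _ (Iic_subset_Iic.2 (not_lt.1 hle)))
    rw [hn.2] at this
    exact absurd (this.trans hc) (not_le.2 hlt)
  · -- Points of `B n` close to different points of `A` are different.
    obtain ⟨δ, hδ, hsep⟩ : ∃ δ > 0, ∀ x ∈ A ∩ Iic s, ∀ y ∈ A ∩ Iic s, x ≠ y → 2 * δ ≤ |x - y| := by
      set F := (hfin.prod hfin).toFinset.filter fun p => p.1 ≠ p.2 with hF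
      rcases F.eq_empty_or_nonempty with h | h
      · refine ⟨1, one_pos, fun x hx y hy hxy => ?_⟩
        have : (x, y) ∈ F := by simp [hF, hxy, hx.1, mem_Iic.1 hx.2, hy.1, mem_Iic.1 hy.2]
        simp [h] at this
      · obtain ⟨p, hp, hmin⟩ := F.exists_min_image (fun p => |p.1 - p.2|) h
        have hne : p.1 ≠ p.2 := (Finset.mem_filter.1 hp).2
        refine ⟨|p.1 - p.2| / 2, half_pos (abs_pos.2 (sub_ne_zero.2 hne)), fun x hx y hy hxy => ?_⟩
        have := hmin (x, y) (by simp [hF, hxy, hx.1, mem_Iic.1 hx.2, hy.1, mem_Iic.1 hy.2])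
        simpa [mul_div_cancel₀] using this
    set δ' := min δ ((R - s) / 2) with hδ'
    have hδ'pos : 0 < δ' := lt_min hδ (by linarith)
    have hall : ∀ᶠ n in atTop, ∀ ζ ∈ A ∩ Iic s, ∃ y ∈ B n, |y - ζ| < δ' :=
      (eventually_all_finite hfin).2 fun ζ hζ => happrox ζ hζ.1 δ' hδ'pos
    filter_upwards [hB, hall] with n hn hn'
    by_contra hle
    choose! y hyB hyd using hn'
    have hmaps : MapsTo y (A ∩ Iic s) ((B n ∩ Iic (t n)) \ {t n}) := by
      intro ζ hζ
      have h1 := (abs_lt.1 (hyd ζ hζ)).2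
      have h2 : δ' ≤ (R - s) / 2 := min_le_right _ _
      have h3 : ζ ≤ s := hζ.2
      have h4 : y ζ < t n := by linarith
      exact ⟨⟨hyB ζ hζ, h4.le⟩, h4.ne⟩
    have hinj : InjOn y (A ∩ Iic s) := by
      intro ζ hζ ζ' hζ' heq
      by_contra hne
      have h1 := hsep ζ hζ ζ' hζ' hne
      have h2 := hyd ζ hζ
      have h3 := hyd ζ' hζ'
      have h4 : δ' ≤ δ := min_le_left _ _
      rw [heq] at h2
      have : |ζ - ζ'| ≤ |y ζ' - ζ| + |y ζ' - ζ'| := by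
        rw [abs_sub_comm (y ζ') ζ]
        exact abs_sub_le _ _ _
      linarith
    have h1 := encard_le_encard_of_injOn hmaps hinj
    have hmem : t n ∈ B n ∩ Iic (t n) := ⟨hn.1, self_mem_Iic⟩
    have hfinB : (B n ∩ Iic (t n)).Finite := finite_of_encard_eq_coe hn.2
    have h2 : ((B n ∩ Iic (t n)) \ {t n}).encard < (B n ∩ Iic (t n)).encard :=
      (hfinB.subset sdiff_subset).encard_lt_encard
        ⟨sdiff_subset, fun h => (h hmem).2 rfl⟩
    rw [hn.2] at h2
    rw [hA.2] at h1
    exact absurd h1 (not_le.2 h2)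

section ZeroCounting

variable {f f' : ℝ → ℝ} {g g' : ℕ → ℝ → ℝ}

/-- Near a simple zero of the limit function the approximating functions change sign. -/
lemma eventually_exists_zero_near {ζ : ℝ} (hf : HasDerivAt f (f' ζ) ζ) (hζ : f ζ = 0)
    (hsimple : f' ζ ≠ 0) (hgc : ∀ᶠ n in atTop, Continuous (g n))
    (hlim : ∀ x, Tendsto (fun n => g n x) atTop (𝓝 (f x))) {δ : ℝ} (hδ : 0 < δ) :
    ∀ᶠ n in atTop, ∃ y, g n y = 0 ∧ |y - ζ| < δ := by
  obtain ⟨x₁, x₂, hx₁, hx₂, hx, hneg⟩ : ∃ x₁ x₂, ζ - δ < x₁ ∧ x₂ < ζ + δ ∧ x₁ ≤ x₂ ∧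
      f x₁ * f x₂ < 0 := by
    have hslope := hasDerivAt_iff_tendsto_slope.1 hf
    have hpos : ∀ᶠ x in 𝓝[≠] ζ, 0 < slope f ζ x * f' ζ :=
      (hslope.mul_const (f' ζ)).eventually_const_lt (mul_self_pos.2 hsimple)
    have hl := (hpos.filter_mono (nhdsLT_le_nhdsNE ζ)).and (Ioo_mem_nhdsLT (sub_lt_self ζ hδ))
    have hr := (hpos.filter_mono (nhdsGT_le_nhdsNE ζ)).and (Ioo_mem_nhdsGT (lt_add_of_pos_right ζ hδ))
    obtain ⟨x₁, h1, h1'⟩ := hl.exists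
    obtain ⟨x₂, h2, h2'⟩ := hr.exists
    refine ⟨x₁, x₂, h1'.1, h2'.2, (h1'.2.trans h2'.1).le, ?_⟩
    simp only [slope_def_field, hζ, sub_zero] at h1 h2
    have e1 : x₁ - ζ < 0 := sub_neg.2 h1'.2
    have e2 : 0 < x₂ - ζ := sub_pos.2 h2'.1
    have h3 : f x₁ * f' ζ < 0 := by
      have := mul_neg_of_pos_of_neg h1 e1
      have e : f x₁ / (x₁ - ζ) * f' ζ * (x₁ - ζ) = f x₁ * f' ζ := by
        field_simp [e1.ne]
      rwa [e] at this
    have h4 : 0 < f x₂ * f' ζ := by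
      have := mul_pos h2 e2
      have e : f x₂ / (x₂ - ζ) * f' ζ * (x₂ - ζ) = f x₂ * f' ζ := by
        field_simp [e2.ne']
      rwa [e] at this
    have h5 := mul_neg_of_neg_of_pos h3 h4
    have h6 : 0 < f' ζ ^ 2 := by positivity
    by_contra hge
    nlinarith
  filter_upwards [hgc, ((hlim x₁).mul (hlim x₂)).eventually_lt_const hneg] with n hc hn
  have : ∃ y ∈ Icc x₁ x₂, g n y = 0 := by
    rcases mul_neg_iff.1 hn with ⟨h1, h2⟩ | ⟨h1, h2⟩
    · exact intermediate_value_Icc' hx hc.continuousOn ⟨h2.le, h1.le⟩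
    · exact intermediate_value_Icc hx hc.continuousOn ⟨h1.le, h2.le⟩
  obtain ⟨y, hy, hy0⟩ := this
  exact ⟨y, hy0, abs_lt.2 ⟨by linarith [hy.1], by linarith [hy.2]⟩⟩

/-- If all zeros of the limit function in `[0, R]` are simple, then two zeros of the approximating
functions cannot merge there (Rolle's theorem), and no zero appears at a point where the limit
does not vanish; compactness makes both statements uniform. -/
lemma eventually_encard_zeros_le (R : ℝ) (hf0 : f 0 ≠ 0)
    (hsimple : ∀ x, 0 < x → f x = 0 → f' x ≠ 0)
    (hg : ∀ᶠ n in atTop, ∀ x, HasDerivAt (g n) (g' n x) x)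
    (hlim : ∀ x, Tendsto (fun p : ℕ × ℝ => g p.1 p.2) (atTop ×ˢ 𝓝 x) (𝓝 (f x)))
    (hlim' : ∀ x, Tendsto (fun p : ℕ × ℝ => g' p.1 p.2) (atTop ×ˢ 𝓝 x) (𝓝 (f' x))) :
    ∀ᶠ n in atTop, ({x | 0 < x ∧ g n x = 0} ∩ Iic R).encard ≤
      ({x | 0 < x ∧ f x = 0} ∩ Iic R).encard := by
  have hloc : ∀ x ∈ Icc 0 R, ∃ U ∈ 𝓝 x, ∀ᶠ n in atTop, ∀ y ∈ U, ∀ y' ∈ U,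
      g n y = 0 → g n y' = 0 → f x = 0 ∧ y = y' := by
    intro x hx
    by_cases hfx : f x = 0
    · have hxpos : 0 < x := lt_of_le_of_ne hx.1 fun h => hf0 (h ▸ hfx)
      obtain ⟨P, hP, Q, hQ, hPQ⟩ :=
        eventually_prod_iff.1 ((hlim' x).eventually_ne (hsimple x hxpos hfx))
      obtain ⟨ε, hε, hball⟩ := Metric.eventually_nhds_iff_ball.1 hQ
      refine ⟨Metric.ball x ε, Metric.ball_mem_nhds x hε, ?_⟩
      filter_upwards [hP, hg] with n hn hgn
      have key : ∀ y ∈ Metric.ball x ε, ∀ y' ∈ Metric.ball x ε,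
          g n y = 0 → g n y' = 0 → ¬ y < y' := by
        intro y hy y' hy' h0 h0' hlt
        obtain ⟨c, hc, hc0⟩ := exists_hasDerivAt_eq_zero (f := g n) (f' := g' n) hlt
          (fun z _ => (hgn z).continuousAt.continuousWithinAt) (h0.trans h0'.symm)
          (fun z _ => hgn z)
        refine hPQ hn (hball c ?_) hc0
        exact (convex_ball x ε).ordConnected.out hy hy' ⟨hc.1.le, hc.2.le⟩
      intro y hy y' hy' h0 h0'
      exact ⟨hfx, le_antisymm (not_lt.1 (key y' hy' y hy h0' h0)) (not_lt.1 (key y hy y' hy' h0 h0'))⟩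
    · obtain ⟨P, hP, Q, hQ, hPQ⟩ := eventually_prod_iff.1 ((hlim x).eventually_ne hfx)
      refine ⟨{y | Q y}, hQ, ?_⟩
      filter_upwards [hP] with n hn y hy y' _ h0
      exact absurd h0 (hPQ hn hy)
  choose! U hU hev using hloc
  obtain ⟨t, ht, hcover⟩ := isCompact_Icc.elim_nhds_subcover U hU
  have hall : ∀ᶠ n in atTop, ∀ x ∈ t, ∀ y ∈ U x, ∀ y' ∈ U x,
      g n y = 0 → g n y' = 0 → f x = 0 ∧ y = y' :=
    (eventually_all_finset t).2 fun x hx => hev x (ht x hx)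
  filter_upwards [hall] with n hn
  have hex : ∀ y ∈ {x | 0 < x ∧ g n x = 0} ∩ Iic R, ∃ x ∈ t, y ∈ U x := by
    intro y hy
    simpa using hcover (show y ∈ Icc 0 R from ⟨hy.1.1.le, hy.2⟩)
  choose! c hct hcU using hex
  refine encard_le_encard_of_injOn (f := c) ?_ ?_
  · intro y hy
    have h1 := (hn (c y) (hct y hy) y (hcU y hy) y (hcU y hy) hy.1.2 hy.1.2).1
    have h2 := ht (c y) (hct y hy)
    exact ⟨⟨lt_of_le_of_ne h2.1 fun h => hf0 (h ▸ h1), h1⟩, h2.2⟩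
  · intro y hy y' hy' heq
    exact (hn (c y) (hct y hy) y (hcU y hy) y' (heq ▸ hcU y' hy') hy.1.2 hy'.1.2).2

end ZeroCounting

/-! ### Entries of the matrices and the error bound -/

lemma meshSize_pos {a : ℝ} (ha : -1 < a) (n : ℕ) : 0 < meshSize a n := by
  have : (0 : ℝ) ≤ n := Nat.cast_nonneg n
  exact one_div_pos.2 (by linarith)

lemma neg_one_pow_succ_mul_self (i : ℕ) : (-1 : ℝ) ^ (i + 1) * (-1) ^ (i + 1) = 1 := by
  rw [← mul_pow]; simp

lemma laguerreHard_apply (a : ℝ) (n : ℕ) (i j : Fin n) :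
    laguerreHard a n i j = if (j : ℕ) = i then √(2 / meshSize a n) * √(a + i + 1)
      else if (j : ℕ) = i + 1 then -(√(2 / meshSize a n) * √((i : ℝ) + 1)) else 0 := by
  have hflip : ∀ M : Matrix (Fin n) (Fin n) ℝ,
      flipMatrix n * M * flipMatrix n = Matrix.of fun i j => M i.rev j.rev := by
    intro M
    ext i j
    have h : ∀ x : Fin n, (j = x.rev) = (x = j.rev) := by
      intro x
      exact propext ⟨fun h => by rw [h, Fin.rev_rev], fun h => by rw [h, Fin.rev_rev]⟩
    simp [Matrix.mul_apply, flipMatrix, h]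
  have hassoc : flipMatrix n * omegaMatrix n * (laguerreInf a n).transpose * omegaMatrix n *
      flipMatrix n = flipMatrix n * (omegaMatrix n * (laguerreInf a n).transpose * omegaMatrix n) *
      flipMatrix n := by
    simp only [Matrix.mul_assoc]
  rw [laguerreHard, hassoc, hflip, Matrix.smul_apply, Matrix.of_apply, omegaMatrix,
    Matrix.mul_diagonal, Matrix.diagonal_mul, Matrix.transpose_apply, laguerreInf, Matrix.of_apply,
    smul_eq_mul]
  have hi := i.isLt
  have hj := j.isLt
  have hi' : ((i.rev : Fin n) : ℕ) = n - (i + 1) := Fin.val_rev i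
  have hj' : ((j.rev : Fin n) : ℕ) = n - (j + 1) := Fin.val_rev j
  have hjc : (((j.rev : Fin n) : ℕ) : ℝ) = n - (j + 1) := by
    rw [hj', Nat.cast_sub (by omega)]; push_cast; ring
  by_cases h1 : (j : ℕ) = i
  · have e : ((i.rev : Fin n) : ℕ) = (j.rev : Fin n) := by omega
    rw [if_pos h1, if_pos e, e, hjc, h1]
    have e2 : a + n - ((n : ℝ) - ((i : ℕ) + 1)) = a + (i : ℕ) + 1 := by ring
    rw [e2]
    linear_combination (√(2 / meshSize a n) * √(a + (i : ℕ) + 1)) *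
      neg_one_pow_succ_mul_self ((j.rev : Fin n) : ℕ)
  · rw [if_neg h1, if_neg (by omega)]
    by_cases h2 : (j : ℕ) = i + 1
    · have e : ((i.rev : Fin n) : ℕ) = (j.rev : Fin n) + 1 := by omega
      rw [if_pos h2, if_pos e, e, hjc, h2]
      have e2 : (n : ℝ) - 1 - ((n : ℝ) - (((i : ℕ) + 1 : ℕ) + 1)) = (i : ℕ) + 1 := by
        push_cast; ring
      rw [e2, pow_succ (-1 : ℝ) (_ + 1)]
      linear_combination (-(√(2 / meshSize a n) * √((i : ℕ) + 1 : ℝ))) *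
        neg_one_pow_succ_mul_self ((j.rev : Fin n) : ℕ)
    · rw [if_neg h2, if_neg (by omega)]
      simp

lemma besselDiscretization_apply (a : ℝ) (n : ℕ) (i j : Fin n) :
    besselDiscretization a n i j =
      if (j : ℕ) = i then √(meshPoint a n (2 * (i + 1))) / meshSize a n +
        a / (2 * √(meshPoint a n (2 * (i + 1))))
      else if (j : ℕ) = i + 1 then -(√(meshPoint a n (2 * (i + 1))) / meshSize a n) +
        a / (2 * √(meshPoint a n (2 * (i + 1)))) else 0 := by
  have hS : interpMatrix n n i j =
      if (j : ℕ) = i then 1 / 2 else if (j : ℕ) = i + 1 then 1 / 2 else 0 := by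
    rw [interpMatrix, Matrix.smul_apply, omegaMatrix, Matrix.mul_diagonal, Matrix.diagonal_mul,
      nablaMatrix, Matrix.of_apply, smul_eq_mul]
    by_cases h1 : (j : ℕ) = i
    · rw [if_pos h1, if_pos h1, h1]
      linear_combination (1 / 2) * neg_one_pow_succ_mul_self (i : ℕ)
    · rw [if_neg h1, if_neg h1]
      by_cases h2 : (j : ℕ) = i + 1
      · rw [if_pos h2, if_pos h2, h2, pow_succ (-1 : ℝ) (_ + 1)]
        linear_combination (1 / 2) * neg_one_pow_succ_mul_self (i : ℕ)
      · rw [if_neg h2, if_neg h2]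
        simp
  simp only [besselDiscretization, Matrix.add_apply, Matrix.smul_apply, Matrix.diagonal_mul, hS,
    nablaMatrix, Matrix.of_apply, smul_eq_mul]
  split_ifs <;> ring

/-- Taylor expansion of the square root to first order, with an explicit remainder. -/
lemma abs_sqrt_add_sub_le {x d : ℝ} (hx : 0 < x) (hxd : 0 ≤ x + d) :
    |√(x + d) - √x - d / (2 * √x)| ≤ d ^ 2 / (2 * (x * √x)) := by
  set s := √x with hs
  set r := √(x + d) with hr
  have hs0 : 0 < s := Real.sqrt_pos.2 hx
  have hr0 : 0 ≤ r := Real.sqrt_nonneg _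
  have hs2 : s ^ 2 = x := Real.sq_sqrt hx.le
  have hr2 : r ^ 2 = x + d := Real.sq_sqrt hxd
  have hd : d = r ^ 2 - s ^ 2 := by rw [hs2, hr2]; ring
  have e : r - s - d / (2 * s) = -(r - s) ^ 2 / (2 * s) := by
    rw [hd]; field_simp; ring
  rw [e, neg_div, abs_neg, abs_of_nonneg (by positivity), div_le_div_iff₀ (by positivity)
    (by positivity), hd, ← hs2]
  have h1 : s ^ 2 ≤ (r + s) ^ 2 := by nlinarith
  have h2 := mul_le_mul_of_nonneg_left h1 (by positivity : 0 ≤ (r - s) ^ 2 * (2 * s))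
  nlinarith

lemma isUpperBidiagonal_error {a : ℝ} {n : ℕ} {E : Matrix (Fin n) (Fin n) ℝ}
    (hE : laguerreHard a n = besselDiscretization a n + E) : IsUpperBidiagonal E := by
  intro i j h1 h2
  have := congrFun (congrFun hE i) j
  rw [Matrix.add_apply, laguerreHard_apply, besselDiscretization_apply] at this
  simpa [h1, h2] using this.symm

lemma abs_error_le {a : ℝ} (ha : -1 < a) {n : ℕ} {E : Matrix (Fin n) (Fin n) ℝ}
    (hE : laguerreHard a n = besselDiscretization a n + E) {ε : ℝ} (hε : 0 < ε) {i j : Fin n}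
    (hi : ⌈ε / meshSize a n⌉₊ ≤ (i : ℕ) + 1) :
    |E i j| ≤ a ^ 2 / (2 * (ε * √ε)) * meshSize a n := by
  have hEij := congrFun (congrFun hE i) j
  rw [Matrix.add_apply, laguerreHard_apply, besselDiscretization_apply] at hEij
  set h := meshSize a n with hh
  have hpos : 0 < h := meshSize_pos ha n
  set x := meshPoint a n (2 * (i + 1)) with hx
  have hxe : x = h * (a + 2 * ((i : ℕ) + 1)) := by
    rw [hx, meshPoint]; push_cast; ring
  have hi0 : (0 : ℝ) ≤ (i : ℕ) := Nat.cast_nonneg _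
  have hεi : ε ≤ h * ((i : ℕ) + 1) := by
    have := (Nat.le_ceil _).trans (Nat.cast_le.2 hi)
    rw [div_le_iff₀ hpos] at this
    push_cast at this
    linarith
  have hεx : ε ≤ x := by
    rw [hxe]
    exact hεi.trans (mul_le_mul_of_nonneg_left (by linarith) hpos.le)
  have hx0 : 0 < x := hε.trans_le hεx
  -- The entries of `L_hard` are `±√(x ± h a) / h`, and those of the discretization are the terms of
  -- first order at `x`.
  have hbound : ∀ d, d ^ 2 = (h * a) ^ 2 → 0 ≤ x + d →
      |√(x + d) / h - √x / h - d / h / (2 * √x)| ≤ a ^ 2 / (2 * (ε * √ε)) * h := by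
    intro d hd hxd
    have e : √(x + d) / h - √x / h - d / h / (2 * √x) = (√(x + d) - √x - d / (2 * √x)) / h := by
      field_simp
    rw [e, abs_div, abs_of_pos hpos, div_le_iff₀ hpos]
    refine (abs_sqrt_add_sub_le hx0 hxd).trans ?_
    rw [hd]
    calc (h * a) ^ 2 / (2 * (x * √x)) ≤ (h * a) ^ 2 / (2 * (ε * √ε)) := by gcongr
      _ = _ := by ring
  have hsqrt : ∀ y, 0 ≤ y → √(2 / h) * √y = √(2 * h * y) / h := by
    intro y hy
    rw [← Real.sqrt_mul (by positivity), eq_div_iff hpos.ne']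
    nth_rewrite 2 [← Real.sqrt_sq hpos.le]
    rw [← Real.sqrt_mul (by positivity)]
    congr 1
    field_simp
  by_cases h1 : (j : ℕ) = i
  · rw [if_pos h1, if_pos h1, hsqrt _ (by linarith)] at hEij
    have e : 2 * h * (a + (i : ℕ) + 1) = x + h * a := by rw [hxe]; ring
    have hb := hbound (h * a) rfl (by rw [← e]; exact mul_nonneg (by positivity) (by linarith))
    rw [e] at hEij
    convert hb using 2
    rw [mul_div_cancel_left₀ _ hpos.ne']
    linarith
  · rw [if_neg h1, if_neg h1] at hEij
    by_cases h2 : (j : ℕ) = i + 1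
    · rw [if_pos h2, if_pos h2, hsqrt _ (by linarith)] at hEij
      have e : 2 * h * ((i : ℕ) + 1 : ℝ) = x + -(h * a) := by rw [hxe]; ring
      have hb := hbound (-(h * a)) (by ring) (by rw [← e]; positivity)
      rw [e] at hEij
      rw [← abs_neg]
      convert hb using 2
      rw [neg_div, mul_div_cancel_left₀ _ hpos.ne', neg_div]
      linarith
    · rw [if_neg h2, if_neg h2] at hEij
      have : E i j = 0 := by linarith
      rw [this, abs_zero]
      positivity

/-! ### Eigenvectors and Laguerre polynomials -/

/-- A vector, continued by zero beyond its last coordinate. -/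
def zeroExtend {n : ℕ} (w : Fin n → ℝ) (i : ℕ) : ℝ := if h : i < n then w ⟨i, h⟩ else 0

lemma zeroExtend_fin {n : ℕ} (w : Fin n → ℝ) (i : Fin n) : zeroExtend w i = w i := by
  simp [zeroExtend]

lemma zeroExtend_of_le {n : ℕ} (w : Fin n → ℝ) {i : ℕ} (h : n ≤ i) : zeroExtend w i = 0 := by
  simp [zeroExtend, not_lt.2 h]

lemma laguerreHard_mulVec (a : ℝ) {n : ℕ} (w : Fin n → ℝ) (i : Fin n) :
    (laguerreHard a n).mulVec w i = √(2 / meshSize a n) *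
      (√(a + (i : ℕ) + 1) * zeroExtend w i - √((i : ℕ) + 1 : ℝ) * zeroExtend w (i + 1)) := by
  have h1 : (laguerreHard a n).mulVec w i = ∑ j ∈ Finset.range n,
      ((if j = (i : ℕ) then √(2 / meshSize a n) * √(a + (i : ℕ) + 1) * zeroExtend w j else 0) +
      (if j = (i : ℕ) + 1 then
        -(√(2 / meshSize a n) * √((i : ℕ) + 1 : ℝ)) * zeroExtend w j else 0)) := by
    rw [Finset.sum_range, Matrix.mulVec, dotProduct]
    refine Finset.sum_congr rfl fun j _ => ?_
    rw [laguerreHard_apply, zeroExtend_fin]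
    split_ifs <;> first | omega | ring
  rw [h1, Finset.sum_add_distrib, Finset.sum_ite_eq', Finset.sum_ite_eq',
    if_pos (Finset.mem_range.2 i.isLt)]
  split_ifs with h
  · ring
  · rw [zeroExtend_of_le w (not_lt.1 fun h' => h (Finset.mem_range.2 h'))]
    ring

lemma laguerreHard_transpose_mulVec (a : ℝ) {n : ℕ} (y : Fin n → ℝ) (j : Fin n) :
    (laguerreHard a n).transpose.mulVec y j = √(2 / meshSize a n) *
      (√(a + (j : ℕ) + 1) * zeroExtend y j - √((j : ℕ) : ℝ) * zeroExtend y (j - 1)) := by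
  have h1 : (laguerreHard a n).transpose.mulVec y j = ∑ i ∈ Finset.range n,
      ((if i = (j : ℕ) then √(2 / meshSize a n) * √(a + (j : ℕ) + 1) * zeroExtend y i else 0) +
      (if i = (j : ℕ) - 1 then
        -(√(2 / meshSize a n) * √((j : ℕ) : ℝ)) * zeroExtend y i else 0)) := by
    rw [Finset.sum_range, Matrix.mulVec, dotProduct]
    refine Finset.sum_congr rfl fun i _ => ?_
    rw [Matrix.transpose_apply, laguerreHard_apply, zeroExtend_fin]
    rcases Nat.eq_zero_or_pos (j : ℕ) with hj | hj
    · rw [hj]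
      by_cases h : (i : ℕ) = 0
      · simp [h]
      · simp [h, Ne.symm h]
    · have hc : (j : ℕ) = i + 1 → (((i : ℕ) : ℝ) + 1) = ((j : ℕ) : ℝ) := by
        intro h; rw [h]; push_cast; ring
      by_cases h : (i : ℕ) = j
      · rw [if_pos h, if_pos h.symm, if_neg (by omega), h]; ring
      · rw [if_neg h, if_neg (Ne.symm h)]
        by_cases h2 : (j : ℕ) = i + 1
        · rw [if_pos h2, if_pos (by omega), hc h2]; ring
        · rw [if_neg h2, if_neg (by omega)]; ring
  rw [h1, Finset.sum_add_distrib, Finset.sum_ite_eq', Finset.sum_ite_eq',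
    if_pos (Finset.mem_range.2 j.isLt),
    if_pos (Finset.mem_range.2 (lt_of_le_of_lt (Nat.sub_le _ _) j.isLt))]
  ring

lemma laguerreHard_gram_mulVec_zero {a : ℝ} (ha : -1 < a) {n : ℕ} (w : Fin n → ℝ) (hn : 0 < n) :
    (laguerreHard a n).transpose.mulVec ((laguerreHard a n).mulVec w) ⟨0, hn⟩ = 2 / meshSize a n *
      ((a + 1) * zeroExtend w 0 - √(a + 1) * zeroExtend w 1) := by
  have hh := meshSize_pos ha n
  have h1 : √(2 / meshSize a n) ^ 2 = 2 / meshSize a n := Real.sq_sqrt (by positivity)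
  have h2 : √(a + 1) ^ 2 = a + 1 := Real.sq_sqrt (by linarith)
  have e := zeroExtend_fin ((laguerreHard a n).mulVec w) ⟨0, hn⟩
  rw [laguerreHard_mulVec] at e
  rw [laguerreHard_transpose_mulVec]
  simp only [Nat.cast_zero, add_zero, zero_add, Real.sqrt_one, one_mul, Real.sqrt_zero,
    zero_mul, sub_zero] at e ⊢
  rw [e]
  linear_combination (√(a + 1) ^ 2 * zeroExtend w 0 - √(a + 1) * zeroExtend w 1) * h1 +
    2 / meshSize a n * zeroExtend w 0 * h2

lemma laguerreHard_gram_mulVec_succ {a : ℝ} (ha : -1 < a) {n : ℕ} (w : Fin n → ℝ) {i : ℕ}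
    (hi : i + 1 < n) :
    (laguerreHard a n).transpose.mulVec ((laguerreHard a n).mulVec w) ⟨i + 1, hi⟩ =
      2 / meshSize a n * ((a + 2 * i + 3) * zeroExtend w (i + 1)
        - √(a + i + 2) * √((i : ℝ) + 2) * zeroExtend w (i + 2)
        - √((i : ℝ) + 1) * √(a + i + 1) * zeroExtend w i) := by
  have hh := meshSize_pos ha n
  have hi0 : (0 : ℝ) ≤ i := Nat.cast_nonneg i
  have h1 : √(2 / meshSize a n) ^ 2 = 2 / meshSize a n := Real.sq_sqrt (by positivity)
  have h2 : √(a + i + 2) ^ 2 = a + i + 2 := Real.sq_sqrt (by linarith)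
  have h3 : √((i : ℝ) + 1) ^ 2 = i + 1 := Real.sq_sqrt (by linarith)
  have e := zeroExtend_fin ((laguerreHard a n).mulVec w) ⟨i + 1, hi⟩
  have e' := zeroExtend_fin ((laguerreHard a n).mulVec w) ⟨i, by omega⟩
  rw [laguerreHard_mulVec] at e e'
  rw [laguerreHard_transpose_mulVec]
  have c1 : a + ((i + 1 : ℕ) : ℝ) + 1 = a + i + 2 := by push_cast; ring
  have c2 : ((i + 1 : ℕ) : ℝ) + 1 = (i : ℝ) + 2 := by push_cast; ring
  have c3 : ((i + 1 : ℕ) : ℝ) = (i : ℝ) + 1 := by push_cast; ring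
  simp only [Nat.add_sub_cancel, c1, c2] at e e' ⊢
  rw [e, e', c3]
  linear_combination (√(a + i + 2) * (√(a + i + 2) * zeroExtend w (i + 1) -
      √((i : ℝ) + 2) * zeroExtend w (i + 2)) - √((i : ℝ) + 1) * (√(a + i + 1) * zeroExtend w i -
      √((i : ℝ) + 1) * zeroExtend w (i + 1))) * h1 +
    2 / meshSize a n * zeroExtend w (i + 1) * (h2 + h3)

/-- The ratios between the coordinates of an eigenvector and the Laguerre polynomials normalized
at `0`. -/
noncomputable def eigenvectorWeight (a : ℝ) (i : ℕ) : ℝ :=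
  ∏ j ∈ Finset.range i, √(a + j + 1) / √((j : ℝ) + 1)

lemma eigenvectorWeight_pos {a : ℝ} (ha : -1 < a) (i : ℕ) : 0 < eigenvectorWeight a i := by
  refine Finset.prod_pos fun j _ => ?_
  have : (0 : ℝ) ≤ j := Nat.cast_nonneg j
  exact div_pos (Real.sqrt_pos.2 (by linarith)) (Real.sqrt_pos.2 (by linarith))

lemma sqrt_mul_eigenvectorWeight_succ (a : ℝ) (i : ℕ) :
    √((i : ℝ) + 1) * eigenvectorWeight a (i + 1) = √(a + i + 1) * eigenvectorWeight a i := by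
  have : √((i : ℝ) + 1) ≠ 0 := (Real.sqrt_pos.2 (by positivity)).ne'
  rw [eigenvectorWeight, eigenvectorWeight, Finset.prod_range_succ]
  field_simp

/-- The coordinates of an eigenvector of `AᵀA`, `A = L_hard^{∞,a}`, are weighted values of Laguerre
polynomials; the last index `i = n` expresses the equation of the last row. -/
lemma eigenvector_eq_laguerreNormalized {a : ℝ} (ha : -1 < a) {n : ℕ} {w : Fin n → ℝ} {μ : ℝ}
    (hw : (laguerreHard a n).transpose.mulVec ((laguerreHard a n).mulVec w) = μ • w) (i : ℕ)
    (hi : i ≤ n) :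
    zeroExtend w i = eigenvectorWeight a i *
      (zeroExtend w 0 * laguerreNormalized (a + 1) i (meshSize a n / 2 * μ)) := by
  set h := meshSize a n with hh
  have hpos : 0 < h := meshSize_pos ha n
  set x := h / 2 * μ with hx
  have hμ : μ = 2 / h * x := by rw [hx]; field_simp
  -- The common factor `2 / h` of `AᵀA` is divided out, so the recurrence is in `x = h μ / 2`.
  have hzero : zeroExtend w 0 = eigenvectorWeight a 0 *
      (zeroExtend w 0 * laguerreNormalized (a + 1) 0 x) := by
    simp [eigenvectorWeight, laguerreNormalized_zero]
  have hpair : ∀ i < n, zeroExtend w i = eigenvectorWeight a i *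
        (zeroExtend w 0 * laguerreNormalized (a + 1) i x) ∧
      zeroExtend w (i + 1) = eigenvectorWeight a (i + 1) *
        (zeroExtend w 0 * laguerreNormalized (a + 1) (i + 1) x) := by
    intro i
    induction i with
    | zero =>
      intro hn
      refine ⟨hzero, ?_⟩
      have h1 := laguerreHard_gram_mulVec_zero ha w hn
      rw [congrFun hw, Pi.smul_apply, smul_eq_mul, ← zeroExtend_fin w ⟨0, hn⟩, hμ, ← hh,
        mul_assoc] at h1
      have h2 := mul_left_cancel₀ (by positivity : (2 / h) ≠ 0) h1
      have h3 := laguerreNormalized_one (a + 1) x (by linarith)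
      have h4 := sqrt_mul_eigenvectorWeight_succ a 0
      have h5 : √(a + 1) ^ 2 = a + 1 := Real.sq_sqrt (by linarith)
      have h6 : √(a + 1) ≠ 0 := (Real.sqrt_pos.2 (by linarith)).ne'
      simp only [Nat.cast_zero, zero_add, add_zero, Real.sqrt_one, one_mul] at h2 h4 ⊢
      have h7 : eigenvectorWeight a 0 = 1 := by simp [eigenvectorWeight]
      rw [h4, h7, mul_one]
      refine mul_left_cancel₀ h6 ?_
      linear_combination h2 - zeroExtend w 0 * h3 -
        zeroExtend w 0 * laguerreNormalized (a + 1) 1 x * h5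
    | succ i ih =>
      intro hn
      obtain ⟨ih1, ih2⟩ := ih (by omega)
      refine ⟨ih2, ?_⟩
      have hi0 : (0 : ℝ) ≤ i := Nat.cast_nonneg i
      have h1 := laguerreHard_gram_mulVec_succ ha w hn
      rw [congrFun hw, Pi.smul_apply, smul_eq_mul, ← zeroExtend_fin w ⟨i + 1, hn⟩, hμ, ← hh,
        mul_assoc] at h1
      have h2 := mul_left_cancel₀ (by positivity : (2 / h) ≠ 0) h1
      have h3 := laguerreNormalized_recurrence (b := a + 1) (by linarith) i x
      have h4 := sqrt_mul_eigenvectorWeight_succ a i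
      have h5 := sqrt_mul_eigenvectorWeight_succ a (i + 1)
      have c1 : a + ((i + 1 : ℕ) : ℝ) + 1 = a + i + 2 := by push_cast; ring
      have c2 : ((i + 1 : ℕ) : ℝ) + 1 = (i : ℝ) + 2 := by push_cast; ring
      rw [c1, c2] at h5
      have h6 : √(a + i + 2) ^ 2 = a + i + 2 := Real.sq_sqrt (by linarith)
      have h7 : √((i : ℝ) + 1) ^ 2 = i + 1 := Real.sq_sqrt (by linarith)
      have h8 : √(a + i + 2) ≠ 0 := (Real.sqrt_pos.2 (by linarith)).ne'
      have h9 : √((i : ℝ) + 2) ≠ 0 := (Real.sqrt_pos.2 (by linarith)).ne'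
      refine mul_left_cancel₀ (mul_ne_zero h8 h9) ?_
      simp only at h2
      rw [ih1, ih2] at h2
      change _ * zeroExtend w (i + 2) = _ * (eigenvectorWeight a (i + 2) *
        (zeroExtend w 0 * laguerreNormalized (a + 1) (i + 2) x))
      change √((i : ℝ) + 2) * eigenvectorWeight a (i + 2) = _ at h5
      set W0 := zeroExtend w 0
      set p0 := laguerreNormalized (a + 1) i x
      set p1 := laguerreNormalized (a + 1) (i + 1) x
      set p2 := laguerreNormalized (a + 1) (i + 2) x
      set r0 := eigenvectorWeight a i
      set r1 := eigenvectorWeight a (i + 1)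
      set r2 := eigenvectorWeight a (i + 2)
      linear_combination h2 - W0 * r1 * h3 - √(a + i + 2) * W0 * p2 * h5
        - r1 * W0 * p2 * h6 + √((i : ℝ) + 1) * W0 * p0 * h4 - r1 * W0 * p0 * h7
  rcases Nat.eq_zero_or_pos i with h0 | h0
  · rw [h0]; exact hzero
  · have := (hpair (i - 1) (by omega)).2
    rwa [Nat.sub_add_cancel h0] at this

/-! ### Singular values as zeros of Laguerre polynomials, and their limit -/

/-- The characteristic polynomial of `AᵀA`, `A = L_hard^{∞,a}`, normalized at `0` and in the
variable `z = σ² / 4` for a singular value `σ` of `A`. -/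
noncomputable def scaledLaguerre (a : ℝ) (n : ℕ) (z : ℝ) : ℝ :=
  laguerreNormalized (a + 1) n (2 * meshSize a n * z)

lemma encard_zeros_laguerreNormalized_le (b : ℝ) (n : ℕ) {c : ℝ} (hc : c ≠ 0) :
    {z | 0 < z ∧ laguerreNormalized b n (c * z) = 0}.encard ≤ n := by
  set P : Polynomial ℝ := ∑ k ∈ Finset.range (n + 1),
    Polynomial.C ((-1) ^ k / risingFactorial b k * (n.choose k : ℝ)) * Polynomial.X ^ k with hP
  have heval : ∀ x, P.eval x = laguerreNormalized b n x := by
    intro x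
    rw [hP, Polynomial.eval_finsetSum, laguerreNormalized]
    exact Finset.sum_congr rfl fun k _ => by simp; ring
  have hP0 : P ≠ 0 := by
    intro h
    have := heval 0
    rw [h, Polynomial.eval_zero, laguerreNormalized_zero_right] at this
    exact zero_ne_one this
  have hdeg : P.natDegree ≤ n :=
    Polynomial.natDegree_sum_le_of_forall_le _ _ fun k hk =>
      (Polynomial.natDegree_C_mul_X_pow_le _ _).trans (by
        have := Finset.mem_range.1 hk; omega)
  have hmaps : MapsTo (fun z => c * z) {z | 0 < z ∧ laguerreNormalized b n (c * z) = 0}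
      (P.roots.toFinset : Set ℝ) := by
    intro z hz
    simp [hP0, heval, hz.2]
  have h1 := encard_le_encard_of_injOn hmaps (mul_right_injective₀ hc).injOn
  refine h1.trans ?_
  rw [encard_coe_eq_coe_finsetCard]
  exact_mod_cast (Multiset.toFinset_card_le _).trans ((Polynomial.card_roots' P).trans hdeg)

lemma gram_mulVec_of_eigenvector {n : ℕ} {A : Matrix (Fin n) (Fin n) ℝ} {μ : ℝ}
    {w : EuclideanSpace ℝ (Fin n)}
    (hw : (Matrix.toEuclideanLin A).adjoint (Matrix.toEuclideanLin A w) = μ • w) :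
    A.transpose.mulVec (A.mulVec w.ofLp) = μ • w.ofLp := by
  rw [← Matrix.toEuclideanLin_conjTranspose_eq_adjoint] at hw
  have := congrArg WithLp.ofLp hw
  simpa [Matrix.ofLp_toLpLin, Matrix.toLin'_apply] using this

section Spectrum

variable {a : ℝ} {n : ℕ}

/-- The coordinates of an eigenvector of `AᵀA` are determined by the first one. -/
lemma eigenvector_eq_zero (ha : -1 < a) {μ : ℝ} {w : EuclideanSpace ℝ (Fin n)} (hn : 0 < n)
    (hw : (Matrix.toEuclideanLin (laguerreHard a n)).adjoint
      (Matrix.toEuclideanLin (laguerreHard a n) w) = μ • w) (h0 : w ⟨0, hn⟩ = 0) : w = 0 := by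
  ext i
  have h1 := eigenvector_eq_laguerreNormalized ha (gram_mulVec_of_eigenvector hw) i i.isLt.le
  have h2 := zeroExtend_fin w.ofLp ⟨0, hn⟩
  rw [zeroExtend_fin] at h1
  simp only at h2
  rw [h2] at h1
  simpa [h0] using h1

lemma scaledLaguerre_eigenvalue (ha : -1 < a) {μ : ℝ}
    (hμ : Module.End.HasEigenvalue ((Matrix.toEuclideanLin (laguerreHard a n)).adjoint ∘ₗ
      Matrix.toEuclideanLin (laguerreHard a n)) μ) :
    scaledLaguerre a n (μ / 4) = 0 := by
  obtain ⟨w, hw⟩ := hμ.exists_hasEigenvector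
  have hw' := hw.apply_eq_smul
  rcases Nat.eq_zero_or_pos n with rfl | hn
  · exact absurd (Subsingleton.elim w 0) hw.2
  have h1 := eigenvector_eq_laguerreNormalized ha (gram_mulVec_of_eigenvector hw') n le_rfl
  rw [zeroExtend_of_le _ le_rfl] at h1
  have h2 := zeroExtend_fin w.ofLp ⟨0, hn⟩
  simp only at h2
  have h3 : w ⟨0, hn⟩ ≠ 0 := fun h => hw.2 (eigenvector_eq_zero ha hn hw' h)
  rw [h2] at h1
  have h4 := (eigenvectorWeight_pos ha n).ne'
  rw [scaledLaguerre]
  have e : 2 * meshSize a n * (μ / 4) = meshSize a n / 2 * μ := by ring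
  rw [e]
  simpa [h3, h4] using h1.symm

lemma finrank_eigenspace_le_one (ha : -1 < a) (hn : 0 < n) (μ : ℝ) :
    Module.finrank ℝ (Module.End.eigenspace ((Matrix.toEuclideanLin (laguerreHard a n)).adjoint ∘ₗ
      Matrix.toEuclideanLin (laguerreHard a n)) μ) ≤ 1 := by
  set V := Module.End.eigenspace ((Matrix.toEuclideanLin (laguerreHard a n)).adjoint ∘ₗ
      Matrix.toEuclideanLin (laguerreHard a n)) μ
  set φ : V →ₗ[ℝ] ℝ := (EuclideanSpace.proj (⟨0, hn⟩ : Fin n) :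
    EuclideanSpace ℝ (Fin n) →L[ℝ] ℝ).toLinearMap ∘ₗ V.subtype
  have hinj : Function.Injective φ := by
    rw [← LinearMap.ker_eq_bot, LinearMap.ker_eq_bot']
    intro w hw
    exact Subtype.ext (eigenvector_eq_zero ha hn (Module.End.mem_eigenspace_iff.1 w.2) hw)
  simpa using LinearMap.finrank_le_finrank_of_injective hinj

/-- The `k`-th least singular value of `L_hard^{∞,a}` corresponds to the `k`-th least zero of the
scaled Laguerre polynomial: its `n` distinct zeros are exhausted by the eigenvalues. -/
lemma isKthLeast_singularValue (ha : -1 < a) {k : ℕ} (hk : 1 ≤ k) (hkn : k ≤ n) :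
    IsKthLeast {z | 0 < z ∧ scaledLaguerre a n z = 0} k
      (kthLeastSingularValue (laguerreHard a n) k ^ 2 / 4) := by
  have hn : 0 < n := by omega
  set T := Matrix.toEuclideanLin (laguerreHard a n) with hT
  have hfin : Module.finrank ℝ (EuclideanSpace ℝ (Fin n)) = n := by simp
  have hsym := T.isSymmetric_adjoint_comp_self
  set ev := hsym.eigenvalues hfin with hev
  have hroot : ∀ i, scaledLaguerre a n (ev i / 4) = 0 := fun i =>
    scaledLaguerre_eigenvalue ha (hsym.hasEigenvalue_eigenvalues hfin i)
  -- The eigenvalue `0` is excluded by the value `1` of the normalized polynomial at `0`.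
  have hpos : ∀ i, 0 < ev i := by
    intro i
    refine lt_of_le_of_ne (T.isPositive_adjoint_comp_self.nonneg_eigenvalues hfin i) fun h => ?_
    have := hroot i
    rw [← h, scaledLaguerre, zero_div, mul_zero, laguerreNormalized_zero_right] at this
    exact one_ne_zero this
  have hinj : Function.Injective ev := by
    intro i j hij
    have hcard := hsym.card_filter_eigenvalues_eq hfin (ev i)
    have hle : (Finset.univ.filter fun l => ev l = ev i).card ≤ 1 := by
      have := finrank_eigenspace_le_one (n := n) ha hn (ev i)
      refine le_trans (le_of_eq ?_) this
      simpa using hcard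
    exact Finset.card_le_one.1 hle i (by simp) j (by simp [hij])
  have hanti : StrictAnti ev := (hsym.eigenvalues_antitone hfin).strictAnti_of_injective hinj
  have hlt : n - k < n := by omega
  set i₀ : Fin n := ⟨n - k, hlt⟩ with hi₀
  have hval : kthLeastSingularValue (laguerreHard a n) k ^ 2 = ev i₀ :=
    T.sq_singularValues_of_lt hfin hlt
  rw [hval]
  have hinj4 : Function.Injective fun i => ev i / 4 := fun i j h => hinj (by simpa using h)
  have hset : {z | 0 < z ∧ scaledLaguerre a n z = 0} = (fun i => ev i / 4) '' univ := by
    symm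
    refine Finite.eq_of_subset_of_encard_le ?_ ?_ ?_
    · exact finite_univ.image _
    · rintro _ ⟨i, _, rfl⟩
      exact ⟨div_pos (hpos i) four_pos, hroot i⟩
    · rw [hinj4.encard_image, encard_univ, ENat.card_eq_coe_fintype_card, Fintype.card_fin]
      exact encard_zeros_laguerreNormalized_le (a + 1) n
        (mul_ne_zero two_ne_zero (meshSize_pos ha n).ne')
  refine ⟨⟨div_pos (hpos _) four_pos, hroot _⟩, ?_⟩
  have himg : {z | 0 < z ∧ scaledLaguerre a n z = 0} ∩ Iic (ev i₀ / 4) =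
      (fun i => ev i / 4) '' (Finset.Ici i₀ : Finset (Fin n)) := by
    rw [hset]
    ext z
    constructor
    · rintro ⟨⟨i, _, rfl⟩, hi⟩
      refine ⟨i, ?_, rfl⟩
      have : ev i ≤ ev i₀ := by
        have := mem_Iic.1 hi
        linarith
      simpa using hanti.le_iff_ge.1 this
    · rintro ⟨i, hi, rfl⟩
      refine ⟨⟨i, mem_univ _, rfl⟩, ?_⟩
      have : ev i ≤ ev i₀ := hanti.antitone (by simpa using hi)
      exact mem_Iic.2 (by linarith)
  rw [himg, hinj4.encard_image, encard_coe_eq_coe_finsetCard, Fin.card_Ici]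
  congr 1
  simp only [hi₀]
  omega

end Spectrum

lemma tendsto_mul_meshSize (a : ℝ) :
    Tendsto (fun n : ℕ => (n : ℝ) * (2 * meshSize a n)) atTop (𝓝 1) := by
  have h : Tendsto (fun n : ℕ => (a + 1) / (n : ℝ)) atTop (𝓝 0) :=
    tendsto_const_nhds.div_atTop tendsto_natCast_atTop_atTop
  have h2 : Tendsto (fun n : ℕ => 2 / (2 + (a + 1) / (n : ℝ))) atTop (𝓝 (2 / (2 + 0))) :=
    tendsto_const_nhds.div (tendsto_const_nhds.add h) (by norm_num)
  rw [add_zero, div_self two_ne_zero] at h2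
  refine h2.congr' ?_
  filter_upwards [eventually_gt_atTop 0] with n hn
  have : (n : ℝ) ≠ 0 := by positivity
  have e : 2 + (a + 1) / (n : ℝ) = (2 * n + a + 1) / n := by
    field_simp
    ring
  rw [e, meshSize, div_div_eq_mul_div]
  ring

lemma tendsto_scaledLaguerre {a : ℝ} (ha : -1 < a) (z : ℝ) :
    Tendsto (fun p : ℕ × ℝ => scaledLaguerre a p.1 p.2) (atTop ×ˢ 𝓝 z)
      (𝓝 (hypLimit (a + 1) z)) := by
  refine tendsto_laguerreNormalized (by linarith) tendsto_fst ?_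
  have := ((tendsto_mul_meshSize a).comp tendsto_fst).mul
    (tendsto_snd : Tendsto Prod.snd ((atTop : Filter ℕ) ×ˢ 𝓝 z) (𝓝 z))
  rw [one_mul] at this
  refine this.congr fun p => ?_
  simp only [Function.comp_apply]
  ring

/-- The derivative of the scaled Laguerre polynomial, again a Laguerre polynomial. For `n = 0` the
factor `n` makes the truncated `n - 1` harmless. -/
noncomputable def scaledLaguerreDeriv (a : ℝ) (n : ℕ) (z : ℝ) : ℝ :=
  -(n * (2 * meshSize a n)) / (a + 1) *
    laguerreNormalized (a + 1 + 1) (n - 1) (2 * meshSize a n * z)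

lemma hasDerivAt_scaledLaguerre {a : ℝ} (ha : -1 < a) {n : ℕ} (hn : 0 < n) (z : ℝ) :
    HasDerivAt (scaledLaguerre a n) (scaledLaguerreDeriv a n z) z := by
  obtain ⟨m, rfl⟩ := Nat.exists_eq_succ_of_ne_zero hn.ne'
  have h1 := hasDerivAt_laguerreNormalized (b := a + 1) (by linarith) m
    (2 * meshSize a (m + 1) * z)
  have h2 := h1.comp z ((hasDerivAt_id z).const_mul (2 * meshSize a (m + 1)))
  refine HasDerivAt.congr_deriv (f := scaledLaguerre a (m + 1)) h2 ?_
  rw [scaledLaguerreDeriv, Nat.succ_eq_add_one, Nat.add_sub_cancel]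
  ring

lemma tendsto_scaledLaguerreDeriv {a : ℝ} (ha : -1 < a) (z : ℝ) :
    Tendsto (fun p : ℕ × ℝ => scaledLaguerreDeriv a p.1 p.2) (atTop ×ˢ 𝓝 z)
      (𝓝 (-hypLimit (a + 1 + 1) z / (a + 1))) := by
  have h1 : Tendsto (fun p : ℕ × ℝ => (p.1 : ℝ) * (2 * meshSize a p.1)) (atTop ×ˢ 𝓝 z) (𝓝 1) :=
    (tendsto_mul_meshSize a).comp tendsto_fst
  have h0 : Tendsto (fun p : ℕ × ℝ => 2 * meshSize a p.1) (atTop ×ˢ 𝓝 z) (𝓝 0) := by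
    have h3 : Tendsto (fun n : ℕ => (n : ℝ) * (2 * meshSize a n) * (n : ℝ)⁻¹) atTop (𝓝 (1 * 0)) :=
      (tendsto_mul_meshSize a).mul tendsto_inv_atTop_nhds_zero_nat
    rw [mul_zero] at h3
    have h4 : Tendsto (fun n : ℕ => 2 * meshSize a n) atTop (𝓝 0) := by
      refine h3.congr' ?_
      filter_upwards [eventually_gt_atTop 0] with n hn
      have : (n : ℝ) ≠ 0 := by positivity
      field_simp
    exact h4.comp tendsto_fst
  have hz : Tendsto (fun p : ℕ × ℝ => p.2) ((atTop : Filter ℕ) ×ˢ 𝓝 z) (𝓝 z) := tendsto_snd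
  have h2 : Tendsto (fun p : ℕ × ℝ => laguerreNormalized (a + 1 + 1) (p.1 - 1)
      (2 * meshSize a p.1 * p.2)) (atTop ×ˢ 𝓝 z) (𝓝 (hypLimit (a + 1 + 1) z)) := by
    refine tendsto_laguerreNormalized (by linarith)
      ((tendsto_sub_atTop_nat 1).comp tendsto_fst) ?_
    have h5 := (h1.sub h0).mul hz
    rw [sub_zero, one_mul] at h5
    refine h5.congr' ?_
    have hev : ∀ᶠ p : ℕ × ℝ in atTop ×ˢ 𝓝 z, 0 < p.1 := tendsto_fst.eventually_gt_atTop 0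
    filter_upwards [hev] with p hp
    rw [Nat.cast_sub (by omega)]
    push_cast
    ring
  have h6 := (h1.neg.div_const (a + 1)).mul h2
  have e : -1 / (a + 1) * hypLimit (a + 1 + 1) z = -hypLimit (a + 1 + 1) z / (a + 1) := by ring
  rw [e] at h6
  exact h6

lemma deriv_hypLimit_ne_zero {b x : ℝ} (hb : 0 < b) (hx : 0 < x) (h0 : hypLimit b x = 0) :
    -hypLimit (b + 1) x / b ≠ 0 :=
  div_ne_zero (neg_ne_zero.2 (hypLimit_succ_ne_zero hb hx h0)) hb.ne'

lemma eventually_exists_zero_scaledLaguerre_near {a z δ : ℝ} (ha : -1 < a) (hz : 0 < z)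
    (h0 : hypLimit (a + 1) z = 0) (hδ : 0 < δ) :
    ∀ᶠ n in atTop, ∃ y ∈ {z | 0 < z ∧ scaledLaguerre a n z = 0}, |y - z| < δ := by
  have hb : 0 < a + 1 := by linarith
  have hc : ∀ᶠ n in atTop, Continuous (scaledLaguerre a n) := by
    filter_upwards [eventually_gt_atTop 0] with n hn
    exact continuous_iff_continuousAt.2 fun x => (hasDerivAt_scaledLaguerre ha hn x).continuousAt
  have hlim : ∀ x, Tendsto (fun n => scaledLaguerre a n x) atTop (𝓝 (hypLimit (a + 1) x)) :=
    fun x => Tendsto.comp (f := fun n : ℕ => (n, x)) (tendsto_scaledLaguerre ha x)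
      (tendsto_id.prodMk tendsto_const_nhds)
  -- A distance below `z` keeps the zero positive.
  have := eventually_exists_zero_near (f := hypLimit (a + 1)) (g := scaledLaguerre a)
    (f' := fun x => -hypLimit (a + 1 + 1) x / (a + 1)) (hasDerivAt_hypLimit hb z) h0
    (deriv_hypLimit_ne_zero hb hz h0) hc hlim (lt_min hδ hz)
  filter_upwards [this] with n hn
  obtain ⟨y, hy0, hy⟩ := hn
  refine ⟨y, ⟨?_, hy0⟩, hy.trans_le (min_le_left _ _)⟩
  have h1 := (abs_lt.1 hy).1
  have h2 := min_le_right δ z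
  linarith

lemma eventually_encard_zeros_scaledLaguerre_le {a : ℝ} (ha : -1 < a) (R : ℝ) :
    ∀ᶠ n in atTop, ({z | 0 < z ∧ scaledLaguerre a n z = 0} ∩ Iic R).encard ≤
      ({z | 0 < z ∧ hypLimit (a + 1) z = 0} ∩ Iic R).encard := by
  have hb : 0 < a + 1 := by linarith
  refine eventually_encard_zeros_le (f' := fun x => -hypLimit (a + 1 + 1) x / (a + 1))
    (g' := scaledLaguerreDeriv a) R ?_ ?_ ?_ ?_ ?_
  · rw [hypLimit_zero]; exact one_ne_zero
  · exact fun x hx h0 => deriv_hypLimit_ne_zero hb hx h0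
  · filter_upwards [eventually_gt_atTop 0] with n hn x using hasDerivAt_scaledLaguerre ha hn x
  · exact tendsto_scaledLaguerre ha
  · exact tendsto_scaledLaguerreDeriv ha

/-- Convergence of the singular values at the hard edge; the limit is `2 √ζ` because the zeros are
expressed in the variable `z = σ² / 4`. -/
lemma tendsto_kthLeastSingularValue {a : ℝ} (ha : -1 < a) {k : ℕ} (hk : 1 ≤ k) {ζ : ℝ}
    (hζ : IsKthLeast {z | 0 < z ∧ hypLimit (a + 1) z = 0} k ζ) :
    Tendsto (fun n : ℕ => kthLeastSingularValue (laguerreHard a n) k) atTop (𝓝 (2 * √ζ)) := by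
  have hfirst : ∀ᶠ n in atTop, IsKthLeast {z | 0 < z ∧ scaledLaguerre a n z = 0} k
      (kthLeastSingularValue (laguerreHard a n) k ^ 2 / 4) := by
    filter_upwards [eventually_ge_atTop k] with n hn
    exact isKthLeast_singularValue ha hk hn
  have key := tendsto_of_isKthLeast hζ hfirst
    (fun z hz δ hδ => eventually_exists_zero_scaledLaguerre_near ha hz.1 hz.2 hδ)
    (eventually_encard_zeros_scaledLaguerre_le ha)
  have h2 := (key.sqrt).const_mul 2
  refine h2.congr fun n => ?_
  have h3 : 0 ≤ kthLeastSingularValue (laguerreHard a n) k := LinearMap.singularValues_nonneg _ _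
  generalize kthLeastSingularValue (laguerreHard a n) k = x at h3
  have e : x ^ 2 / 4 = (x / 2) ^ 2 := by ring
  rw [e, Real.sqrt_sq (by positivity)]
  ring

/-! ### Integrability near `0` and the regular solution -/

lemma memLp_two_of_continuousOn {f : ℝ → ℝ} (hf : ContinuousOn f (Icc 0 1)) :
    MemLp f 2 (volume.restrict (Ioo 0 1)) := by
  obtain ⟨C, hC⟩ := isCompact_Icc.exists_bound_of_continuousOn hf
  refine MemLp.of_bound ((hf.mono Ioo_subset_Icc_self).aestronglyMeasurable measurableSet_Ioo) C ?_
  filter_upwards [ae_restrict_mem measurableSet_Ioo] with x hx using hC x (Ioo_subset_Icc_self hx)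

lemma memLp_two_rpow_half {a : ℝ} (ha : -1 < a) :
    MemLp (fun x : ℝ => x ^ (a / 2)) 2 (volume.restrict (Ioo 0 1)) := by
  have hc : ContinuousOn (fun x : ℝ => x ^ (a / 2)) (Ioo 0 1) := fun x hx =>
    (Real.continuousAt_rpow_const x _ (Or.inl hx.1.ne')).continuousWithinAt
  rw [memLp_two_iff_integrable_sq (hc.aestronglyMeasurable measurableSet_Ioo)]
  have h1 : IntegrableOn (fun x : ℝ => x ^ a) (Ioo 0 1) := by
    have := intervalIntegral.intervalIntegrable_rpow' (a := 0) (b := 1) ha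
    rwa [intervalIntegrable_iff_integrableOn_Ioo_of_le zero_le_one] at this
  refine IntegrableOn.congr_fun h1 (fun x hx => ?_) measurableSet_Ioo
  rw [← Real.rpow_natCast, ← Real.rpow_mul hx.1.le]
  congr 1
  push_cast
  ring

lemma integrableOn_rpow_half_mul {a : ℝ} (ha : -1 < a) {v : ℝ → ℝ}
    (hv : MemLp v 2 (volume.restrict (Ioo 0 1))) :
    IntegrableOn (fun x => x ^ (a / 2) * v x) (Ioo 0 1) :=
  (memLp_two_rpow_half ha).integrable_mul hv

lemma memLp_two_rpow_half_mul {a : ℝ} (ha : -1 < a) {r : ℝ → ℝ} (hr : ContinuousOn r (Icc 0 1)) :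
    MemLp (fun x => x ^ (a / 2) * r x) 2 (volume.restrict (Ioo 0 1)) := by
  obtain ⟨C, hC⟩ := isCompact_Icc.exists_bound_of_continuousOn hr
  refine MemLp.of_le_mul (c := C) (memLp_two_rpow_half ha)
    ((memLp_two_rpow_half ha).1.mul ((hr.mono Ioo_subset_Icc_self).aestronglyMeasurable
      measurableSet_Ioo)) ?_
  filter_upwards [ae_restrict_mem measurableSet_Ioo] with x hx
  rw [norm_mul, mul_comm]
  exact mul_le_mul_of_nonneg_right (hC x (Ioo_subset_Icc_self hx)) (norm_nonneg _)

/-- An integrable function is not bounded below by a multiple of `1 / x` near `0`. -/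
lemma not_eventually_le_mul_abs_of_integrableOn {g : ℝ → ℝ} (hg : IntegrableOn g (Ioo 0 1)) {c : ℝ}
    (hc : 0 < c) : ¬ ∀ᶠ x in 𝓝[>] (0 : ℝ), c ≤ x * |g x| := by
  intro hev
  obtain ⟨η, hη, hsub⟩ := mem_nhdsGT_iff_exists_Ioo_subset.1 (hev.and (Ioo_mem_nhdsGT one_pos))
  have hη : (0 : ℝ) < η := hη
  have hg' : IntegrableOn g (Ioo 0 η) := hg.mono_set fun x hx => (hsub hx).2
  have hinv : IntegrableOn (fun x : ℝ => x⁻¹) (Ioo 0 η) := by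
    refine Integrable.mono' (hg'.abs.const_mul c⁻¹) measurable_inv.aestronglyMeasurable ?_
    filter_upwards [ae_restrict_mem measurableSet_Ioo] with x hx
    have hx0 : 0 < x := hx.1
    have := (hsub hx).1
    rw [Real.norm_eq_abs, abs_of_pos (inv_pos.2 hx0), inv_mul_eq_div, le_div_iff₀ hc,
      inv_mul_le_iff₀ hx0]
    exact this
  rw [← intervalIntegrable_iff_integrableOn_Ioo_of_le hη.le, intervalIntegrable_inv_iff] at hinv
  rcases hinv with h | h
  · exact hη.ne h
  · exact h left_mem_uIcc

/-- In terms of `q = x^(-a/2) v` and `P = ∫₀ˣ y^a q`, the singular value problem `𝒥_a v = σ u`,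
`𝒥_a^* u = σ v` reads `q' = -κ x^(-a-1) P`, `P' = x^a q` with `κ = σ² / 4`. This is the component `q`
of its solution that is regular at `0`. -/
noncomputable def regularSolution (a κ x : ℝ) : ℝ := hypLimit (a + 1) (κ * x)

/-- The component `P = ∫₀ˣ y^a q` of the solution that is regular at `0`. -/
noncomputable def regularFlux (a κ x : ℝ) : ℝ :=
  x ^ (a + 1) * hypLimit (a + 1 + 1) (κ * x) / (a + 1)

section RegularSolution

variable {a κ : ℝ}

lemma hasDerivAt_regularSolution (ha : -1 < a) {x : ℝ} (hx : 0 < x) :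
    HasDerivAt (regularSolution a κ) (-κ * x ^ (-(a + 1)) * regularFlux a κ x) x := by
  have hb : 0 < a + 1 := by linarith
  have h := (hasDerivAt_hypLimit hb (κ * x)).comp x ((hasDerivAt_id x).const_mul κ)
  refine HasDerivAt.congr_deriv (f := regularSolution a κ) h ?_
  have hp := (Real.rpow_pos_of_pos hx (a + 1)).ne'
  rw [regularFlux, Real.rpow_neg hx.le]
  field_simp

lemma hasDerivAt_regularFlux (ha : -1 < a) {x : ℝ} (hx : 0 < x) :
    HasDerivAt (regularFlux a κ) (x ^ a * regularSolution a κ x) x := by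
  have hb : 0 < a + 1 := by linarith
  have hp := Real.hasDerivAt_rpow_const (x := x) (p := a + 1) (Or.inl hx.ne')
  have h := (hasDerivAt_hypLimit (b := a + 1 + 1) (by linarith) (κ * x)).comp x
    ((hasDerivAt_id x).const_mul κ)
  refine HasDerivAt.congr_deriv (f := regularFlux a κ) ((hp.mul h).div_const (a + 1)) ?_
  have hc := hypLimit_contiguous (b := a + 1) hb (κ * x)
  simp only [Function.comp_apply, mul_one, add_sub_cancel_right]
  rw [Real.rpow_add_one hx.ne', regularSolution]
  have h2 : a + 1 + 1 ≠ 0 := by linarith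
  field_simp
  linear_combination (-1) * hc

lemma continuous_regularSolution (ha : -1 < a) : Continuous (regularSolution a κ) :=
  (continuous_hypLimit (by linarith)).comp (continuous_const.mul continuous_id)

lemma continuous_regularFlux (ha : -1 < a) : Continuous (regularFlux a κ) := by
  have h1 := Real.continuous_rpow_const (q := a + 1) (by linarith)
  have h2 : Continuous fun x : ℝ => hypLimit (a + 1 + 1) (κ * x) :=
    (continuous_hypLimit (by linarith)).comp (continuous_const.mul continuous_id)
  exact (h1.mul h2).div_const _

lemma regularSolution_zero (a κ : ℝ) : regularSolution a κ 0 = 1 := by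
  rw [regularSolution, mul_zero, hypLimit_zero]

end RegularSolution

/-! ### The Wronskian and primitives -/

section Wronskian

variable {a κ : ℝ}

/-- A multiple of the regular flux by an admissible function cannot have a nonzero limit at `0`:
otherwise `x^a r` would be at least as large as a multiple of `1 / x`. -/
lemma eq_zero_of_tendsto_mul_regularFlux (ha : -1 < a) {r : ℝ → ℝ} {L : ℝ}
    (hr : IntegrableOn (fun x => x ^ a * r x) (Ioo 0 1))
    (hL : Tendsto (fun x => r x * regularFlux a κ x) (𝓝[>] 0) (𝓝 L)) : L = 0 := by
  by_contra hne
  have hb : 0 < a + 1 := by linarith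
  have hLpos : 0 < |L| := abs_pos.2 hne
  refine not_eventually_le_mul_abs_of_integrableOn hr
    (c := (a + 1) * |L| / 4) (by positivity) ?_
  have h1 : ∀ᶠ x in 𝓝[>] (0 : ℝ), |L| / 2 < |r x * regularFlux a κ x| :=
    hL.abs.eventually_const_lt (by linarith)
  have h2 : Tendsto (fun x => |hypLimit (a + 1 + 1) (κ * x)|) (𝓝[>] 0) (𝓝 1) := by
    have hc : Continuous fun x : ℝ => |hypLimit (a + 1 + 1) (κ * x)| :=
      ((continuous_hypLimit (by linarith)).comp (continuous_const.mul continuous_id)).abs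
    have := (hc.tendsto 0).mono_left (nhdsWithin_le_nhds (s := Ioi 0))
    simpa [hypLimit_zero] using this
  filter_upwards [h1, h2.eventually_lt_const one_lt_two, self_mem_nhdsWithin] with x hx1 hx2 hx
  have hx0 : 0 < x := hx
  have hp := Real.rpow_pos_of_pos hx0 a
  have e : x * |x ^ a * r x| = x ^ (a + 1) * |r x| := by
    rw [abs_mul, abs_of_pos hp, Real.rpow_add_one hx0.ne']; ring
  rw [e]
  have hp1 := Real.rpow_pos_of_pos hx0 (a + 1)
  rw [regularFlux, abs_mul, abs_div, abs_mul, abs_of_pos hp1, abs_of_pos hb] at hx1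
  have h3 : |r x| * (x ^ (a + 1) * |hypLimit (a + 1 + 1) (κ * x)| / (a + 1)) ≤
      |r x| * (x ^ (a + 1) * 2 / (a + 1)) := by gcongr
  have h4 := hx1.trans_le h3
  have h5 : |r x| * (x ^ (a + 1) * 2 / (a + 1)) = 2 * (x ^ (a + 1) * |r x|) / (a + 1) := by ring
  rw [h5, lt_div_iff₀ hb] at h4
  linarith

lemma regularSolution_sq_add_sq_pos (ha : -1 < a) (hκ : 0 ≤ κ) {x : ℝ} (hx : 0 < x) :
    0 < regularSolution a κ x ^ 2 + regularFlux a κ x ^ 2 := by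
  have hb : 0 < a + 1 := by linarith
  by_cases h : regularSolution a κ x = 0
  · have hκx : 0 < κ * x := by
      refine mul_pos (lt_of_le_of_ne hκ fun h0 => ?_) hx
      rw [regularSolution, ← h0, zero_mul, hypLimit_zero] at h
      exact one_ne_zero h
    have hD := hypLimit_succ_ne_zero hb hκx h
    have : regularFlux a κ x ≠ 0 :=
      div_ne_zero (mul_ne_zero (Real.rpow_pos_of_pos hx _).ne' hD) hb.ne'
    positivity
  · positivity

/-- The Wronskian of a solution and the regular solution is constant, and it vanishes at `0`. So the
two solutions are proportional at each point, hence on the whole interval, as the regular solution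
and its flux have no common zero. -/
lemma exists_eq_mul_regularSolution (ha : -1 < a) (hκ : 0 ≤ κ) {q P : ℝ → ℝ}
    (hq : ∀ x ∈ Ioo (0 : ℝ) 1, HasDerivAt q (-κ * x ^ (-(a + 1)) * P x) x)
    (hP : ∀ x ∈ Ioo (0 : ℝ) 1, HasDerivAt P (x ^ a * q x) x)
    (hP0 : Tendsto P (𝓝[>] 0) (𝓝 0)) (hint : IntegrableOn (fun x => x ^ a * q x) (Ioo 0 1)) :
    ∃ c, ∀ x ∈ Ioo (0 : ℝ) 1, q x = c * regularSolution a κ x := by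
  set Q := regularSolution a κ with hQ
  set G := regularFlux a κ with hG
  have hhalf : (1 / 2 : ℝ) ∈ Ioo (0 : ℝ) 1 := by norm_num
  have hQ' : ∀ x ∈ Ioo (0 : ℝ) 1, HasDerivAt Q (-κ * x ^ (-(a + 1)) * G x) x := fun x hx =>
    hasDerivAt_regularSolution ha hx.1
  have hG' : ∀ x ∈ Ioo (0 : ℝ) 1, HasDerivAt G (x ^ a * Q x) x := fun x hx =>
    hasDerivAt_regularFlux ha hx.1
  have hconst : ∀ F : ℝ → ℝ, (∀ x ∈ Ioo (0 : ℝ) 1, HasDerivAt F 0 x) →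
      ∀ x ∈ Ioo (0 : ℝ) 1, F x = F (1 / 2) := fun F hF x hx =>
    isOpen_Ioo.is_const_of_deriv_eq_zero isPreconnected_Ioo
      (fun y hy => (hF y hy).differentiableAt.differentiableWithinAt)
      (fun y hy => (hF y hy).deriv) hx hhalf
  have hW := hconst (fun x => q x * G x - P x * Q x) fun x hx => by
    refine (((hq x hx).mul (hG' x hx)).sub ((hP x hx).mul (hQ' x hx))).congr_deriv ?_
    ring
  have hW0 : q (1 / 2) * G (1 / 2) - P (1 / 2) * Q (1 / 2) = 0 := by
    refine eq_zero_of_tendsto_mul_regularFlux (κ := κ) ha hint ?_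
    have hQ0 : Tendsto Q (𝓝[>] 0) (𝓝 1) := by
      have := ((continuous_regularSolution (κ := κ) ha).tendsto 0).mono_left
        (nhdsWithin_le_nhds (s := Ioi 0))
      rwa [regularSolution_zero] at this
    have := (hP0.mul hQ0).const_add (q (1 / 2) * G (1 / 2) - P (1 / 2) * Q (1 / 2))
    rw [zero_mul, add_zero] at this
    refine this.congr' ?_
    filter_upwards [Ioo_mem_nhdsGT one_pos] with x hx
    have := hW x hx
    linarith
  have hprop : ∀ x ∈ Ioo (0 : ℝ) 1, q x * G x = P x * Q x := by
    intro x hx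
    have := hW x hx
    linarith
  -- The factor of proportionality is differentiable, and its derivative vanishes.
  have hN : ∀ x ∈ Ioo (0 : ℝ) 1, Q x ^ 2 + G x ^ 2 ≠ 0 := fun x hx =>
    (regularSolution_sq_add_sq_pos ha hκ hx.1).ne'
  have hc := hconst (fun x => (q x * Q x + P x * G x) / (Q x ^ 2 + G x ^ 2)) fun x hx => by
    refine ((((hq x hx).mul (hQ' x hx)).add ((hP x hx).mul (hG' x hx))).fun_div
      (((hQ' x hx).pow 2).add ((hG' x hx).pow 2)) (hN x hx)).congr_deriv ?_
    have h := hprop x hx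
    refine div_eq_zero_iff.2 (Or.inl ?_)
    simp only [Pi.add_apply, Pi.mul_apply, Pi.pow_apply, Nat.cast_ofNat, Nat.add_one_sub_one,
      pow_one]
    generalize x ^ (-(a + 1)) = α
    generalize x ^ a = β
    linear_combination ((κ * α - β) * (Q x ^ 2 - G x ^ 2)) * h
  refine ⟨(q (1 / 2) * Q (1 / 2) + P (1 / 2) * G (1 / 2)) / (Q (1 / 2) ^ 2 + G (1 / 2) ^ 2),
    fun x hx => ?_⟩
  have h := hc x hx
  rw [← h, div_mul_eq_mul_div, eq_div_iff (hN x hx)]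
  linear_combination G x * hprop x hx

end Wronskian

section Adjoint

variable {a : ℝ}

/-- The product rule behind the substitution `v = x^(a/2) q`. -/
lemma hasDerivAt_rpow_neg_half_mul {v : ℝ → ℝ} {x : ℝ} (hx : 0 < x) (hv : DifferentiableAt ℝ v x) :
    HasDerivAt (fun x => x ^ (-(a / 2)) * v x)
      (-(x ^ (-((a + 1) / 2)) * besselAction a v x / 2)) x := by
  have hp := Real.hasDerivAt_rpow_const (x := x) (p := -(a / 2)) (Or.inl hx.ne')
  refine (hp.mul hv.hasDerivAt).congr_deriv ?_
  have hs : x ^ (-((a + 1) / 2)) = x ^ (-(a / 2)) / √x := by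
    rw [Real.sqrt_eq_rpow, ← Real.rpow_sub hx]
    congr 1
    ring
  have hs0 : √x ≠ 0 := (Real.sqrt_pos.2 hx).ne'
  have hs2 : √x ^ 2 = x := Real.sq_sqrt hx.le
  rw [besselAction, hs, Real.rpow_sub_one hx.ne']
  nth_rewrite 2 [← hs2]
  field_simp
  ring

/-- A differentiable function whose derivative agrees almost everywhere with a continuous function
has this function as its derivative everywhere. -/
lemma hasDerivAt_of_ae_eq_continuousOn {q q' G : ℝ → ℝ}
    (hq : ∀ x ∈ Ioo (0 : ℝ) 1, HasDerivAt q (q' x) x) (hG : ContinuousOn G (Ioo 0 1))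
    (hae : ∀ᵐ x ∂(volume.restrict (Ioo 0 1)), q' x = G x) {x : ℝ} (hx : x ∈ Ioo (0 : ℝ) 1) :
    HasDerivAt q (G x) x := by
  have hsub : ∀ y ∈ Ioo (0 : ℝ) 1, uIcc x y ⊆ Ioo 0 1 := fun y hy =>
    ordConnected_Ioo.uIcc_subset hx hy
  have hGint : ∀ y ∈ Ioo (0 : ℝ) 1, IntervalIntegrable G volume x y := fun y hy =>
    (hG.mono (hsub y hy)).intervalIntegrable
  have heq : ∀ y ∈ Ioo (0 : ℝ) 1, q y = q x + ∫ t in x..y, G t := by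
    intro y hy
    have hae' : ∀ᵐ t ∂(volume.restrict (uIoc x y)), q' t = G t :=
      ae_restrict_of_ae_restrict_of_subset (uIoc_subset_uIcc.trans (hsub y hy)) hae
    have hint : IntervalIntegrable q' volume x y :=
      (hGint y hy).congr_ae (hae'.mono fun t ht => ht.symm)
    have h1 := intervalIntegral.integral_eq_sub_of_hasDerivAt
      (fun t ht => hq t (hsub y hy ht)) hint
    rw [intervalIntegral.integral_congr_ae_restrict hae'] at h1
    linarith
  have hder : HasDerivAt (fun y => q x + ∫ t in x..y, G t) (G x) x := by
    refine HasDerivAt.const_add _ (intervalIntegral.integral_hasDerivAt_right (hGint x hx) ?_ ?_)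
    · exact hG.stronglyMeasurableAtFilter isOpen_Ioo x hx
    · exact hG.continuousAt (Ioo_mem_nhds hx.1 hx.2)
  refine hder.congr_of_eventuallyEq ?_
  filter_upwards [Ioo_mem_nhds hx.1 hx.2] with y hy using heq y hy

lemma continuousOn_primitive {g : ℝ → ℝ} (hg : IntegrableOn g (Ioo 0 1)) :
    ContinuousOn (fun x => ∫ y in (0 : ℝ)..x, g y) (Icc 0 1) := by
  have h := intervalIntegral.continuousOn_primitive_interval (μ := volume) (f := g) (a := 0) (b := 1)
    (by rw [uIcc_of_le zero_le_one]; exact (integrableOn_Icc_iff_integrableOn_Ioo).2 hg)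
  rwa [uIcc_of_le zero_le_one] at h

lemma tendsto_nhdsGT_of_continuousOn_Icc {f : ℝ → ℝ} (hf : ContinuousOn f (Icc 0 1)) :
    Tendsto f (𝓝[>] 0) (𝓝 (f 0)) := by
  have := (hf 0 ⟨le_rfl, zero_le_one⟩).mono_left
    (nhdsWithin_mono (0 : ℝ) (Ioo_subset_Icc_self (a := (0 : ℝ)) (b := 1)))
  rwa [nhdsWithin_Ioo_eq_nhdsGT one_pos] at this

lemma tendsto_nhdsLT_of_continuousOn_Icc {f : ℝ → ℝ} (hf : ContinuousOn f (Icc 0 1)) :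
    Tendsto f (𝓝[<] 1) (𝓝 (f 1)) := by
  have := (hf 1 ⟨zero_le_one, le_rfl⟩).mono_left
    (nhdsWithin_mono (1 : ℝ) (Ioo_subset_Icc_self (a := (0 : ℝ)) (b := 1)))
  rwa [nhdsWithin_Ioo_eq_nhdsLT one_pos] at this

lemma hasDerivAt_primitive {g : ℝ → ℝ} (hg : IntegrableOn g (Ioo 0 1))
    (hc : ContinuousOn g (Ioo 0 1)) {x : ℝ} (hx : x ∈ Ioo (0 : ℝ) 1) :
    HasDerivAt (fun x => ∫ y in (0 : ℝ)..x, g y) (g x) x := by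
  refine intervalIntegral.integral_hasDerivAt_right ?_
    (hc.stronglyMeasurableAtFilter isOpen_Ioo x hx) (hc.continuousAt (Ioo_mem_nhds hx.1 hx.2))
  rw [intervalIntegrable_iff_integrableOn_Ioo_of_le hx.1.le]
  exact hg.mono_set (Ioo_subset_Ioo_right hx.2.le)

end Adjoint

/-! ### Singular functions are multiples of the regular solution -/

section Pairs

variable {a : ℝ}

/-- For a test function `ψ`, the function `φ = x^(a/2) ∫ₓ¹ s^(-(a+1)/2) ψ(s) / 2 ds` belongs to the
domain, and `𝒥_a φ = ψ`. -/
lemma inBesselDomain_of_primitive (ha : -1 < a) {ψ K : ℝ → ℝ} (hψ : Continuous ψ)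
    (hψ0 : ψ 0 = 0)
    (hK : ∀ x, 0 < x → HasDerivAt K (-(ψ x * x ^ (-((a + 1) / 2)) / 2)) x)
    (hKc : Continuous K) (hK1 : K 1 = 0) :
    InBesselDomain a (fun x => x ^ (a / 2) * K x) ∧
      ∀ x ∈ Ioo (0 : ℝ) 1, besselAction a (fun x => x ^ (a / 2) * K x) x = ψ x := by
  have hder : ∀ x, 0 < x → HasDerivAt (fun x => x ^ (a / 2) * K x)
      (a / 2 * x ^ (a / 2 - 1) * K x + x ^ (a / 2) * (-(ψ x * x ^ (-((a + 1) / 2)) / 2))) x :=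
    fun x hx => (Real.hasDerivAt_rpow_const (Or.inl hx.ne')).mul (hK x hx)
  have hact : ∀ x, 0 < x → besselAction a (fun x => x ^ (a / 2) * K x) x = ψ x := by
    intro x hx
    have hs : x ^ (-((a + 1) / 2)) = (x ^ (a / 2) * √x)⁻¹ := by
      rw [Real.sqrt_eq_rpow, ← Real.rpow_add hx, ← Real.rpow_neg hx.le]
      congr 1
      ring
    have hp := (Real.rpow_pos_of_pos hx (a / 2)).ne'
    have hs0 : √x ≠ 0 := (Real.sqrt_pos.2 hx).ne'
    have hs2 : √x ^ 2 = x := Real.sq_sqrt hx.le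
    rw [besselAction, (hder x hx).deriv, hs, Real.rpow_sub_one hx.ne']
    nth_rewrite 3 [← hs2]
    field_simp
    ring
  refine ⟨⟨?_, ?_, ?_, ?_, ?_⟩, fun x hx => hact x hx.1⟩
  · exact fun x hx => (hder x hx.1).differentiableAt.differentiableWithinAt
  · exact memLp_two_rpow_half_mul ha hKc.continuousOn
  · refine (memLp_congr_ae ?_).2 (memLp_two_of_continuousOn hψ.continuousOn)
    filter_upwards [ae_restrict_mem measurableSet_Ioo] with x hx using hact x hx.1
  · have h := (hder 1 one_pos).continuousAt.tendsto.mono_left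
      (nhdsWithin_le_nhds (s := Iio 1))
    simpa [hK1] using h
  · have h : Tendsto ψ (𝓝[>] 0) (𝓝 (ψ 0)) := (hψ.tendsto 0).mono_left nhdsWithin_le_nhds
    rw [hψ0] at h
    refine h.congr' ?_
    filter_upwards [self_mem_nhdsWithin] with x hx using (hact x hx).symm

/-- The adjoint equation, tested on the functions `φ` with `𝒥_a φ = ψ` for an arbitrary test
function `ψ`: the range of `𝒥_a` is dense, so the left singular function is determined. -/
lemma IsBesselAdjoint.ae_eq (ha : -1 < a) {u w : ℝ → ℝ} (h : IsBesselAdjoint a u w)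
    (hw : ContinuousOn w (Ioo 0 1)) :
    ∀ᵐ x ∂(volume.restrict (Ioo 0 1)),
      u x = x ^ (-((a + 1) / 2)) / 2 * ∫ y in (0 : ℝ)..x, y ^ (a / 2) * w y := by
  set g : ℝ → ℝ := fun y => y ^ (a / 2) * w y with hg
  set P : ℝ → ℝ := fun x => ∫ y in (0 : ℝ)..x, g y with hP
  have hrpow : ∀ p : ℝ, ContinuousOn (fun x : ℝ => x ^ p) (Ioo 0 1) := fun p x hx =>
    (Real.continuousAt_rpow_const x _ (Or.inl hx.1.ne')).continuousWithinAt
  have hgint : IntegrableOn g (Ioo 0 1) := integrableOn_rpow_half_mul ha h.memLp_right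
  have hgc : ContinuousOn g (Ioo 0 1) := (hrpow _).mul hw
  have hPc : ContinuousOn P (Icc 0 1) := continuousOn_primitive hgint
  have hP' : ∀ x ∈ Ioo (0 : ℝ) 1, HasDerivAt P (g x) x := fun x hx =>
    hasDerivAt_primitive hgint hgc hx
  set U : ℝ → ℝ := fun x => x ^ (-((a + 1) / 2)) / 2 * P x with hU
  have hUc : ContinuousOn U (Ioo 0 1) :=
    ((hrpow _).div_const 2).mul (hPc.mono Ioo_subset_Icc_self)
  have huint : IntegrableOn u (Ioo 0 1) := h.memLp_left.integrable one_le_two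
  have hloc : LocallyIntegrableOn (fun x => u x - U x) (Ioo 0 1) (volume.restrict (Ioo 0 1)) := by
    have h1 : LocallyIntegrableOn u (Ioo 0 1) (volume.restrict (Ioo 0 1)) :=
      (Integrable.locallyIntegrable huint).locallyIntegrableOn _
    have h2 : LocallyIntegrableOn U (Ioo 0 1) (volume.restrict (Ioo 0 1)) :=
      hUc.locallyIntegrableOn measurableSet_Ioo
    exact h1.sub h2
  have key := isOpen_Ioo.ae_eq_zero_of_integral_contDiff_smul_eq_zero hloc ?_
  · filter_upwards [key, ae_restrict_mem measurableSet_Ioo] with x hx hx'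
    exact sub_eq_zero.1 (hx hx')
  intro ψ hψd hψs hψU
  have hψ : Continuous ψ := hψd.continuous
  have hψ0 : ψ 0 = 0 := by
    by_contra hne
    exact lt_irrefl _ (hψU (subset_tsupport ψ hne)).1
  set k : ℝ → ℝ := fun x => ψ x * x ^ (-((a + 1) / 2)) / 2 with hk
  have hkc : Continuous k := by
    have hsub : tsupport k ⊆ tsupport ψ := by
      refine closure_mono fun x hx => ?_
      intro h0
      exact hx (by simp [hk, h0])
    refine continuous_iff_continuousAt.2 fun x => ?_
    by_cases hx : x ∈ tsupport k
    · have hx0 : x ≠ 0 := (hψU (hsub hx)).1.ne'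
      exact (hψ.continuousAt.mul (Real.continuousAt_rpow_const x _ (Or.inl hx0))).div_const 2
    · exact (continuousAt_const (y := (0 : ℝ))).congr
        ((notMem_tsupport_iff_eventuallyEq.1 hx).symm)
  set K : ℝ → ℝ := fun x => -∫ t in (1 : ℝ)..x, k t with hK
  have hK' : ∀ x, HasDerivAt K (-k x) x := fun x => (hkc.integral_hasStrictDerivAt 1 x).hasDerivAt.neg
  have hKc : Continuous K := continuous_iff_continuousAt.2 fun x => (hK' x).continuousAt
  have hK1 : K 1 = 0 := by simp [hK]
  obtain ⟨hdom, hact⟩ := inBesselDomain_of_primitive ha hψ hψ0 (fun x _ => hK' x) hKc hK1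
  have hadj := h.integral_eq _ hdom
  have hI1 : ∫ x in Ioo (0 : ℝ) 1, besselAction a (fun x => x ^ (a / 2) * K x) x * u x =
      ∫ x in Ioo (0 : ℝ) 1, ψ x * u x :=
    setIntegral_congr_fun measurableSet_Ioo fun x hx => by rw [hact x hx]
  rw [hI1] at hadj
  -- Integration by parts: the boundary terms of `K P` vanish at both ends.
  have hint1 : IntegrableOn (fun x => K x * g x) (Ioo 0 1) := by
    obtain ⟨C, hC⟩ := isCompact_Icc.exists_bound_of_continuousOn
      (hKc.continuousOn (s := Icc (0 : ℝ) 1))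
    refine Integrable.bdd_mul (c := C) hgint hKc.aestronglyMeasurable ?_
    filter_upwards [ae_restrict_mem measurableSet_Ioo] with x hx using hC x (Ioo_subset_Icc_self hx)
  have hint2 : IntegrableOn (fun x => k x * P x) (Ioo 0 1) :=
    ((hkc.continuousOn.mul hPc).integrableOn_Icc).mono_set Ioo_subset_Icc_self
  have hparts : ∫ x in Ioo (0 : ℝ) 1, (-k x * P x + K x * g x) = 0 := by
    have hii : IntervalIntegrable (fun x => -k x * P x + K x * g x) volume 0 1 := by
      rw [intervalIntegrable_iff_integrableOn_Ioo_of_le zero_le_one]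
      have := hint2.neg.add hint1
      refine this.congr_fun (fun x _ => ?_) measurableSet_Ioo
      simp
    have h0 := tendsto_nhdsGT_of_continuousOn_Icc (hKc.continuousOn.mul hPc)
    have h1 := tendsto_nhdsLT_of_continuousOn_Icc (hKc.continuousOn.mul hPc)
    have := intervalIntegral.integral_eq_sub_of_hasDerivAt_of_tendsto zero_lt_one
      (fun x hx => (hK' x).mul (hP' x hx)) hii h0 h1
    rw [intervalIntegral.integral_of_le zero_le_one, integral_Ioc_eq_integral_Ioo] at this
    rw [this]
    simp [hK1, hP]
  have hsplit : ∫ x in Ioo (0 : ℝ) 1, (-k x * P x + K x * g x) =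
      (∫ x in Ioo (0 : ℝ) 1, K x * g x) - ∫ x in Ioo (0 : ℝ) 1, k x * P x := by
    rw [← integral_sub hint1 hint2]
    exact integral_congr_ae (ae_of_all _ fun x => by ring)
  have hI2 : ∫ x in Ioo (0 : ℝ) 1, x ^ (a / 2) * K x * w x = ∫ x in Ioo (0 : ℝ) 1, K x * g x := by
    refine integral_congr_ae (ae_of_all _ fun x => ?_)
    simp only [hg]
    ring
  have hψu : IntegrableOn (fun x => ψ x * u x) (Ioo 0 1) := by
    obtain ⟨C, hC⟩ := isCompact_Icc.exists_bound_of_continuousOn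
      (hψ.continuousOn (s := Icc (0 : ℝ) 1))
    refine Integrable.bdd_mul (c := C) huint hψ.aestronglyMeasurable ?_
    filter_upwards [ae_restrict_mem measurableSet_Ioo] with x hx using hC x (Ioo_subset_Icc_self hx)
  have hfin : ∫ x in Ioo (0 : ℝ) 1, ψ x • (u x - U x) =
      (∫ x in Ioo (0 : ℝ) 1, ψ x * u x) - ∫ x in Ioo (0 : ℝ) 1, k x * P x := by
    rw [← integral_sub hψu hint2]
    refine integral_congr_ae (ae_of_all _ fun x => ?_)
    simp only [hU, hk, smul_eq_mul]
    ring
  rw [hfin, hadj, hI2]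
  linarith

/-- Every right singular function is a multiple of the regular solution. -/
lemma IsBesselSingularPair.eq_regularSolution (ha : -1 < a) {σ : ℝ} {v u : ℝ → ℝ}
    (h : IsBesselSingularPair a σ v u) :
    ∃ c, c ≠ 0 ∧ ∀ x ∈ Ioo (0 : ℝ) 1, v x = c * (x ^ (a / 2) * regularSolution a (σ ^ 2 / 4) x) := by
  have hvd : ∀ x ∈ Ioo (0 : ℝ) 1, DifferentiableAt ℝ v x := fun x hx =>
    h.domain.differentiable.differentiableAt (Ioo_mem_nhds hx.1 hx.2)
  have hvc : ContinuousOn v (Ioo 0 1) := h.domain.differentiable.continuousOn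
  have hrpow : ∀ p : ℝ, ContinuousOn (fun x : ℝ => x ^ p) (Ioo 0 1) := fun p x hx =>
    (Real.continuousAt_rpow_const x _ (Or.inl hx.1.ne')).continuousWithinAt
  set g : ℝ → ℝ := fun y => y ^ (a / 2) * v y with hg
  have hgint : IntegrableOn g (Ioo 0 1) := integrableOn_rpow_half_mul ha h.domain.memLp
  have hgc : ContinuousOn g (Ioo 0 1) := (hrpow _).mul hvc
  set P : ℝ → ℝ := fun x => ∫ y in (0 : ℝ)..x, g y with hP
  have hPc : ContinuousOn P (Icc 0 1) := continuousOn_primitive hgint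
  set q : ℝ → ℝ := fun x => x ^ (-(a / 2)) * v x with hq
  have hvq : ∀ x ∈ Ioo (0 : ℝ) 1, v x = x ^ (a / 2) * q x := by
    intro x hx
    rw [hq, ← mul_assoc, ← Real.rpow_add hx.1, add_neg_cancel, Real.rpow_zero, one_mul]
  have hgq : ∀ x ∈ Ioo (0 : ℝ) 1, g x = x ^ a * q x := by
    intro x hx
    simp only [hg]
    rw [hvq x hx, ← mul_assoc, ← Real.rpow_add hx.1]
    congr 2
    ring
  have hadj := h.adjoint_eq.ae_eq ha (continuousOn_const.mul hvc)
  have hq' : ∀ x ∈ Ioo (0 : ℝ) 1,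
      HasDerivAt q (-(σ ^ 2 / 4) * x ^ (-(a + 1)) * P x) x := by
    intro x hx
    refine hasDerivAt_of_ae_eq_continuousOn
      (fun y hy => hasDerivAt_rpow_neg_half_mul hy.1 (hvd y hy))
      (G := fun x => -(σ ^ 2 / 4) * x ^ (-(a + 1)) * P x)
      ((continuousOn_const.mul (hrpow _)).mul (hPc.mono Ioo_subset_Icc_self)) ?_ hx
    filter_upwards [hadj, ae_restrict_mem measurableSet_Ioo] with y hy hy'
    have hσ : ∫ t in (0 : ℝ)..y, t ^ (a / 2) * (σ * v t) = σ * P y := by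
      rw [hP, ← intervalIntegral.integral_const_mul]
      refine intervalIntegral.integral_congr fun t _ => ?_
      simp only [hg]
      ring
    have hsq : y ^ (-(a + 1)) = y ^ (-((a + 1) / 2)) * y ^ (-((a + 1) / 2)) := by
      rw [← Real.rpow_add hy'.1]
      congr 1
      ring
    rw [h.action_eq y hy', hy, hσ, hsq]
    ring
  have hP0 : Tendsto P (𝓝[>] 0) (𝓝 0) := by
    have := tendsto_nhdsGT_of_continuousOn_Icc hPc
    simpa [hP] using this
  obtain ⟨c, hc⟩ := exists_eq_mul_regularSolution ha (by positivity : 0 ≤ σ ^ 2 / 4) hq'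
    (fun x hx => hgq x hx ▸ hasDerivAt_primitive hgint hgc hx) hP0
    (hgint.congr_fun hgq measurableSet_Ioo)
  have hv : ∀ x ∈ Ioo (0 : ℝ) 1,
      v x = c * (x ^ (a / 2) * regularSolution a (σ ^ 2 / 4) x) := by
    intro x hx
    rw [hvq x hx, hc x hx]
    ring
  refine ⟨c, fun h0 => ?_, hv⟩
  obtain ⟨x, hx, hne⟩ := h.ne_zero
  exact hne (by rw [hv x hx, h0, zero_mul])

/-- The boundary condition at `1` turns a singular value into a zero. -/
lemma IsBesselSingularPair.hypLimit_eq_zero (ha : -1 < a) {σ : ℝ} {v u : ℝ → ℝ}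
    (h : IsBesselSingularPair a σ v u) : hypLimit (a + 1) (σ ^ 2 / 4) = 0 := by
  obtain ⟨c, hc0, hc⟩ := h.eq_regularSolution ha
  have h1 : Tendsto (fun x : ℝ => c * (x ^ (a / 2) * regularSolution a (σ ^ 2 / 4) x)) (𝓝[<] 1)
      (𝓝 (c * ((1 : ℝ) ^ (a / 2) * regularSolution a (σ ^ 2 / 4) 1))) := by
    have hp : ContinuousAt (fun x : ℝ => x ^ (a / 2)) 1 :=
      Real.continuousAt_rpow_const 1 _ (Or.inl one_ne_zero)
    exact (((hp.mul (continuous_regularSolution ha).continuousAt).const_mul c).tendsto).mono_left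
      nhdsWithin_le_nhds
  have h2 : Tendsto (fun x : ℝ => c * (x ^ (a / 2) * regularSolution a (σ ^ 2 / 4) x)) (𝓝[<] 1)
      (𝓝 0) := by
    refine h.domain.at_one.congr' ?_
    filter_upwards [Ioo_mem_nhdsLT one_pos] with x hx using hc x hx
  have := tendsto_nhds_unique h1 h2
  simpa [hc0, regularSolution] using this

end Pairs

/-! ### Existence of singular pairs and zeros of the Bessel function -/

section Existence

variable {a : ℝ}

/-- The left singular function belonging to the right singular function
`x^(a/2) ₀F₁(; a + 1; -σ² x / 4)`. -/
noncomputable def leftSingularFunction (a σ x : ℝ) : ℝ :=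
  σ / (2 * (a + 1)) * (x ^ ((a + 1) / 2) * hypLimit (a + 1 + 1) (σ ^ 2 / 4 * x))

lemma continuous_leftSingularFunction (ha : -1 < a) (σ : ℝ) :
    Continuous (leftSingularFunction a σ) := by
  have h1 := Real.continuous_rpow_const (q := (a + 1) / 2) (by linarith)
  have h2 : Continuous fun x : ℝ => hypLimit (a + 1 + 1) (σ ^ 2 / 4 * x) :=
    (continuous_hypLimit (by linarith)).comp (continuous_const.mul continuous_id)
  exact continuous_const.mul (h1.mul h2)

lemma leftSingularFunction_eq (ha : -1 < a) (σ : ℝ) {x : ℝ} (hx : 0 < x) :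
    leftSingularFunction a σ x =
      σ / 2 * (x ^ (-((a + 1) / 2)) * regularFlux a (σ ^ 2 / 4) x) := by
  have hb : a + 1 ≠ 0 := by linarith
  have e : x ^ (a + 1) = x ^ ((a + 1) / 2) * x ^ ((a + 1) / 2) := by
    rw [← Real.rpow_add hx]
    congr 1
    ring
  have hp := (Real.rpow_pos_of_pos hx ((a + 1) / 2)).ne'
  rw [leftSingularFunction, regularFlux, Real.rpow_neg hx.le, e]
  field_simp

lemma hasDerivAt_rpow_half_mul_regularSolution (ha : -1 < a) (σ : ℝ) {x : ℝ} (hx : 0 < x) :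
    HasDerivAt (fun x => x ^ (a / 2) * regularSolution a (σ ^ 2 / 4) x)
      (a / 2 * x ^ (a / 2 - 1) * regularSolution a (σ ^ 2 / 4) x +
        x ^ (a / 2) * (-(σ ^ 2 / 4) * x ^ (-(a + 1)) * regularFlux a (σ ^ 2 / 4) x)) x :=
  (Real.hasDerivAt_rpow_const (Or.inl hx.ne')).mul (hasDerivAt_regularSolution ha hx)

lemma besselAction_regularSolution (ha : -1 < a) (σ : ℝ) {x : ℝ} (hx : 0 < x) :
    besselAction a (fun x => x ^ (a / 2) * regularSolution a (σ ^ 2 / 4) x) x =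
      σ * leftSingularFunction a σ x := by
  have hsq : x ^ (-(a + 1)) = x ^ (-((a + 1) / 2)) * x ^ (-((a + 1) / 2)) := by
    rw [← Real.rpow_add hx]
    congr 1
    ring
  have hs : x ^ (-((a + 1) / 2)) = (x ^ (a / 2) * √x)⁻¹ := by
    rw [Real.sqrt_eq_rpow, ← Real.rpow_add hx, ← Real.rpow_neg hx.le]
    congr 1
    ring
  have hp := (Real.rpow_pos_of_pos hx (a / 2)).ne'
  have hs0 : √x ≠ 0 := (Real.sqrt_pos.2 hx).ne'
  have hs2 : √x ^ 2 = x := Real.sq_sqrt hx.le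
  rw [besselAction, (hasDerivAt_rpow_half_mul_regularSolution ha σ hx).deriv,
    leftSingularFunction_eq ha σ hx, hsq, hs, Real.rpow_sub_one hx.ne']
  generalize regularSolution a (σ ^ 2 / 4) x = Q
  generalize regularFlux a (σ ^ 2 / 4) x = G
  have hx0 := hx.ne'
  field_simp
  rw [hs2]
  ring

lemma inBesselDomain_regularSolution (ha : -1 < a) {σ : ℝ}
    (h0 : hypLimit (a + 1) (σ ^ 2 / 4) = 0) :
    InBesselDomain a (fun x => x ^ (a / 2) * regularSolution a (σ ^ 2 / 4) x) := by
  have hu : Continuous fun x => σ * leftSingularFunction a σ x :=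
    continuous_const.mul (continuous_leftSingularFunction ha σ)
  refine ⟨?_, ?_, ?_, ?_, ?_⟩
  · exact fun x hx => (hasDerivAt_rpow_half_mul_regularSolution ha σ
      hx.1).differentiableAt.differentiableWithinAt
  · exact memLp_two_rpow_half_mul ha (continuous_regularSolution ha).continuousOn
  · refine (memLp_congr_ae ?_).2 (memLp_two_of_continuousOn hu.continuousOn)
    filter_upwards [ae_restrict_mem measurableSet_Ioo] with x hx
    exact besselAction_regularSolution ha σ hx.1
  · have h := (hasDerivAt_rpow_half_mul_regularSolution ha σ
      one_pos).continuousAt.tendsto.mono_left (nhdsWithin_le_nhds (s := Iio 1))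
    have e : regularSolution a (σ ^ 2 / 4) 1 = 0 := by rw [regularSolution, mul_one, h0]
    simpa [e] using h
  · have h : Tendsto (fun x => σ * leftSingularFunction a σ x) (𝓝[>] 0)
        (𝓝 (σ * leftSingularFunction a σ 0)) := (hu.tendsto 0).mono_left nhdsWithin_le_nhds
    have e : leftSingularFunction a σ 0 = 0 := by
      have hne : (a + 1) / 2 ≠ 0 := by linarith
      rw [leftSingularFunction, Real.zero_rpow hne]
      ring
    rw [e, mul_zero] at h
    refine h.congr' ?_
    filter_upwards [self_mem_nhdsWithin] with x hx
    exact (besselAction_regularSolution ha σ hx).symm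

/-- A function with integrable derivative on `(0, 1)` has a limit at `0`. -/
lemma exists_tendsto_nhdsGT_zero {f f' : ℝ → ℝ} (hf : ∀ x ∈ Ioo (0 : ℝ) 1, HasDerivAt f (f' x) x)
    (hint : IntegrableOn f' (Ioo 0 1)) : ∃ L, Tendsto f (𝓝[>] 0) (𝓝 L) := by
  have hsub : ∀ y ∈ Ioo (0 : ℝ) 1, uIcc (1 / 2 : ℝ) y ⊆ Ioo 0 1 := fun y hy =>
    ordConnected_Ioo.uIcc_subset (by norm_num) hy
  have hii : ∀ x ∈ Icc (0 : ℝ) 1, ∀ y ∈ Icc (0 : ℝ) 1, IntervalIntegrable f' volume x y := by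
    intro x hx y hy
    have h01 : IntervalIntegrable f' volume 0 1 :=
      (intervalIntegrable_iff_integrableOn_Ioo_of_le zero_le_one).2 hint
    refine h01.mono_set ?_
    rw [uIcc_of_le zero_le_one]
    exact ordConnected_Icc.uIcc_subset hx hy
  have hhalf : (1 / 2 : ℝ) ∈ Icc (0 : ℝ) 1 := by norm_num
  have heq : ∀ x ∈ Ioo (0 : ℝ) 1,
      f x = f (1 / 2) + ((∫ t in (0 : ℝ)..x, f' t) - ∫ t in (0 : ℝ)..(1 / 2), f' t) := by
    intro x hx
    have hx' := Ioo_subset_Icc_self hx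
    rw [intervalIntegral.integral_interval_sub_left (hii 0 ⟨le_rfl, zero_le_one⟩ x hx')
      (hii 0 ⟨le_rfl, zero_le_one⟩ _ hhalf),
      intervalIntegral.integral_eq_sub_of_hasDerivAt (fun t ht => hf t (hsub x hx ht))
        (hii _ hhalf x hx')]
    ring
  have hlim := tendsto_nhdsGT_of_continuousOn_Icc (continuousOn_primitive hint)
  refine ⟨_, ((hlim.sub_const (∫ t in (0 : ℝ)..(1 / 2), f' t)).const_add (f (1 / 2))).congr' ?_⟩
  filter_upwards [Ioo_mem_nhdsGT one_pos] with x hx using (heq x hx).symm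

/-- Green's formula: the boundary term at `1` vanishes for functions in the domain, and the boundary
term at `0` vanishes because functions in the domain are square integrable. -/
lemma isBesselAdjoint_leftSingularFunction (ha : -1 < a) {σ : ℝ} (hσ : 0 < σ) :
    IsBesselAdjoint a (leftSingularFunction a σ)
      (fun x => σ * (x ^ (a / 2) * regularSolution a (σ ^ 2 / 4) x)) := by
  have hu := memLp_two_of_continuousOn (continuous_leftSingularFunction ha σ).continuousOn
  have hv : MemLp (fun x => σ * (x ^ (a / 2) * regularSolution a (σ ^ 2 / 4) x)) 2
      (volume.restrict (Ioo 0 1)) :=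
    (memLp_two_rpow_half_mul ha (continuous_regularSolution ha).continuousOn).const_mul σ
  refine ⟨hu, hv, fun φ hφ => ?_⟩
  set G := regularFlux a (σ ^ 2 / 4) with hG
  set Q := regularSolution a (σ ^ 2 / 4) with hQ
  have hφd : ∀ x ∈ Ioo (0 : ℝ) 1, DifferentiableAt ℝ φ x := fun x hx =>
    hφ.differentiable.differentiableAt (Ioo_mem_nhds hx.1 hx.2)
  set ρ : ℝ → ℝ := fun x => x ^ (-(a / 2)) * φ x with hρ
  have hφρ : ∀ x ∈ Ioo (0 : ℝ) 1, x ^ (a / 2) * φ x = x ^ a * ρ x := by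
    intro x hx
    simp only [hρ]
    rw [← mul_assoc, ← Real.rpow_add hx.1]
    congr 2
    ring
  have hint1 : IntegrableOn (fun x => besselAction a φ x * leftSingularFunction a σ x) (Ioo 0 1) :=
    hφ.memLp_action.integrable_mul hu
  have hint2 : IntegrableOn (fun x => φ x * (σ * (x ^ (a / 2) * Q x))) (Ioo 0 1) :=
    hφ.memLp.integrable_mul hv
  set B' : ℝ → ℝ := fun x => σ⁻¹ * (φ x * (σ * (x ^ (a / 2) * Q x)) -
    besselAction a φ x * leftSingularFunction a σ x) with hB'
  have hB'int : IntegrableOn B' (Ioo 0 1) := (hint2.sub hint1).const_mul σ⁻¹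
  have hder : ∀ x ∈ Ioo (0 : ℝ) 1, HasDerivAt (fun x => ρ x * G x) (B' x) x := by
    intro x hx
    refine ((hasDerivAt_rpow_neg_half_mul hx.1 (hφd x hx)).mul
      (hasDerivAt_regularFlux ha hx.1)).congr_deriv ?_
    have h1 : ρ x * (x ^ a * Q x) = x ^ (a / 2) * φ x * Q x := by
      rw [hφρ x hx]; ring
    change _ + ρ x * (x ^ a * Q x) = _
    rw [h1]
    simp only [hB', leftSingularFunction_eq ha σ hx.1]
    field_simp
    ring
  obtain ⟨L, hL⟩ := exists_tendsto_nhdsGT_zero hder hB'int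
  have hL0 : L = 0 := by
    refine eq_zero_of_tendsto_mul_regularFlux ha ?_ hL
    exact (integrableOn_rpow_half_mul ha hφ.memLp).congr_fun hφρ measurableSet_Ioo
  have h1 : Tendsto (fun x => ρ x * G x) (𝓝[<] 1) (𝓝 0) := by
    have hp : Tendsto (fun x : ℝ => x ^ (-(a / 2))) (𝓝[<] 1) (𝓝 ((1 : ℝ) ^ (-(a / 2)))) :=
      (Real.continuousAt_rpow_const 1 _ (Or.inl one_ne_zero)).tendsto.mono_left nhdsWithin_le_nhds
    have hGl : Tendsto G (𝓝[<] 1) (𝓝 (G 1)) :=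
      ((continuous_regularFlux ha).tendsto 1).mono_left nhdsWithin_le_nhds
    simpa using (hp.mul hφ.at_one).mul hGl
  have hii : IntervalIntegrable B' volume 0 1 :=
    (intervalIntegrable_iff_integrableOn_Ioo_of_le zero_le_one).2 hB'int
  have hFTC := intervalIntegral.integral_eq_sub_of_hasDerivAt_of_tendsto zero_lt_one hder hii hL h1
  rw [intervalIntegral.integral_of_le zero_le_one, integral_Ioc_eq_integral_Ioo, hL0, sub_zero,
    integral_const_mul, integral_sub hint2 hint1] at hFTC
  have := (mul_eq_zero.1 hFTC).resolve_left (inv_ne_zero hσ.ne')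
  linarith

lemma isBesselSingularPair_regularSolution (ha : -1 < a) {σ : ℝ} (hσ : 0 < σ)
    (h0 : hypLimit (a + 1) (σ ^ 2 / 4) = 0) :
    IsBesselSingularPair a σ (fun x => x ^ (a / 2) * regularSolution a (σ ^ 2 / 4) x)
      (leftSingularFunction a σ) := by
  refine ⟨inBesselDomain_regularSolution ha h0, ?_,
    fun x hx => besselAction_regularSolution ha σ hx.1, isBesselAdjoint_leftSingularFunction ha hσ⟩
  have hlim : Tendsto (regularSolution a (σ ^ 2 / 4)) (𝓝[>] 0) (𝓝 1) := by
    have := ((continuous_regularSolution (κ := σ ^ 2 / 4) ha).tendsto 0).mono_left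
      (nhdsWithin_le_nhds (s := Ioi 0))
    rwa [regularSolution_zero] at this
  obtain ⟨x, hx, hx'⟩ := ((hlim.eventually_ne one_ne_zero).and (Ioo_mem_nhdsGT one_pos)).exists
  exact ⟨x, hx', mul_ne_zero (Real.rpow_pos_of_pos hx'.1 _).ne' hx⟩

end Existence

lemma Gamma_add_nat_eq_mul_risingFactorial {b : ℝ} (hb : 0 < b) (m : ℕ) :
    Real.Gamma (m + b) = Real.Gamma b * risingFactorial b m := by
  induction m with
  | zero => simp [risingFactorial]
  | succ m ih =>
    have h : (m : ℝ) + b ≠ 0 := by positivity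
    rw [risingFactorial_succ, ← mul_assoc, ← ih, mul_comm, add_comm b, ← Real.Gamma_add_one h]
    congr 1
    push_cast
    ring

lemma besselJ_eq {a : ℝ} (ha : -1 < a) {t : ℝ} (ht : 0 < t) :
    besselJ a t = (t / 2) ^ a / Real.Gamma (a + 1) * hypLimit (a + 1) (t ^ 2 / 4) := by
  have hb : 0 < a + 1 := by linarith
  rw [besselJ, hypLimit, ← tsum_mul_left]
  refine tsum_congr fun m => ?_
  have h2 : 0 < t / 2 := half_pos ht
  have e : (t / 2) ^ (2 * (m : ℝ) + a) = (t ^ 2 / 4) ^ m * (t / 2) ^ a := by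
    rw [Real.rpow_add h2, mul_comm (2 : ℝ), Real.rpow_mul h2.le, Real.rpow_natCast, Real.rpow_two,
      ← pow_mul, mul_comm m 2, pow_mul]
    congr 2
    ring
  have hG := (Real.Gamma_pos_of_pos hb).ne'
  have hr := (risingFactorial_pos hb m).ne'
  have hf : (m.factorial : ℝ) ≠ 0 := by positivity
  rw [e, add_assoc, Gamma_add_nat_eq_mul_risingFactorial hb]
  field_simp

lemma besselJ_eq_zero_iff {a : ℝ} (ha : -1 < a) {t : ℝ} (ht : 0 < t) :
    besselJ a t = 0 ↔ hypLimit (a + 1) (t ^ 2 / 4) = 0 := by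
  have h1 := (Real.rpow_pos_of_pos (half_pos ht) a).ne'
  have h2 := (Real.Gamma_pos_of_pos (by linarith : 0 < a + 1)).ne'
  rw [besselJ_eq ha ht]
  simp [h1, h2]

/-- The value `σ = 0` is no singular value since `₀F₁(; a + 1; 0) = 1`. -/
lemma besselSingularValues_eq {a : ℝ} (ha : -1 < a) :
    besselSingularValues a = {t | 0 < t ∧ besselJ a t = 0} := by
  ext σ
  constructor
  · rintro ⟨hσ, v, u, h⟩
    have h0 := h.hypLimit_eq_zero ha
    have hpos : 0 < σ := by
      refine lt_of_le_of_ne hσ fun h' => ?_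
      rw [← h'] at h0
      simp [hypLimit_zero] at h0
    exact ⟨hpos, (besselJ_eq_zero_iff ha hpos).2 h0⟩
  · rintro ⟨hσ, h⟩
    exact ⟨hσ.le, _, _, isBesselSingularPair_regularSolution ha hσ ((besselJ_eq_zero_iff ha hσ).1 h)⟩

lemma isKthLeast_besselJ {a : ℝ} (ha : -1 < a) {k : ℕ} {ζ : ℝ}
    (hζ : IsKthLeast {z | 0 < z ∧ hypLimit (a + 1) z = 0} k ζ) :
    IsKthLeast {t | 0 < t ∧ besselJ a t = 0} k (2 * √ζ) := by
  have hmono : StrictMonoOn (fun t : ℝ => t ^ 2 / 4) (Ioi 0) := by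
    intro x hx y _ hxy
    have : x ^ 2 < y ^ 2 := pow_lt_pow_left₀ hxy (le_of_lt hx) two_ne_zero
    simp only
    linarith
  have h := hζ.preimage (g := fun z => 2 * √z) hmono fun z hz => by
    refine ⟨mul_pos two_pos (Real.sqrt_pos.2 hz.1), ?_⟩
    rw [mul_pow, Real.sq_sqrt hz.1.le]
    ring
  convert h using 1
  ext t
  constructor
  · rintro ⟨ht, h0⟩
    exact ⟨ht, by positivity, (besselJ_eq_zero_iff ha ht).1 h0⟩
  · rintro ⟨ht, _, h0⟩
    exact ⟨ht, (besselJ_eq_zero_iff ha ht).2 h0⟩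

theorem mainTheorem3 (a : ℝ) (ha : -1 < a)
    (E : (n : ℕ) → Matrix (Fin n) (Fin n) ℝ)
    (hE : ∀ n : ℕ, laguerreHard a n = besselDiscretization a n + E n) :
    (∀ n : ℕ, IsUpperBidiagonal (E n)) ∧
    (∀ ε : ℝ, 0 < ε → ∃ C : ℝ, ∀ (n : ℕ) (i j : Fin n),
      ⌈ε / meshSize a n⌉₊ ≤ (i : ℕ) + 1 → |E n i j| ≤ C * meshSize a n) ∧
    (∀ (σ : ℝ) (v u v' u' : ℝ → ℝ), 0 ≤ σ →
      IsBesselSingularPair a σ v u → IsBesselSingularPair a σ v' u' →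
        ∃ c : ℝ, ∀ x ∈ Set.Ioo (0 : ℝ) 1, v' x = c * v x) ∧
    (∀ k : ℕ, 1 ≤ k → ∃ s : ℝ,
      IsKthLeast {t : ℝ | 0 < t ∧ besselJ a t = 0} k s ∧
      IsKthLeast (besselSingularValues a) k s ∧
      Filter.Tendsto (fun n : ℕ => kthLeastSingularValue (laguerreHard a n) k)
        Filter.atTop (nhds s)) := by
  refine ⟨fun n => isUpperBidiagonal_error (hE n),
    fun ε hε => ⟨_, fun n i j hi => abs_error_le ha (hE n) hε hi⟩, ?_, fun k hk => ?_⟩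
  · intro σ v u v' u' _ h h'
    obtain ⟨c, hc, hv⟩ := h.eq_regularSolution ha
    obtain ⟨c', _, hv'⟩ := h'.eq_regularSolution ha
    refine ⟨c' / c, fun x hx => ?_⟩
    rw [hv' x hx, hv x hx]
    field_simp
  · have hb : 0 < a + 1 := by linarith
    obtain ⟨ζ, hζ⟩ := exists_isKthLeast (infinite_zeros_hypLimit hb) (finite_zeros_hypLimit hb) hk
    have hs := isKthLeast_besselJ ha hζ
    exact ⟨2 * √ζ, hs, by rwa [besselSingularValues_eq ha], tendsto_kthLeastSingularValue ha hk hζ⟩
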